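/- Let $a,b$ be the multiplicative arithmetic functions with $a(n)=b(n)=\sigma_1(n)$ for odd $n$, and $a(2^m)=2^m$, $b(2^m)=0$ for $m\ge 1$, where $\sigma_1$ is the sum-of-divisors function. Let $\zeta^*(s)=\pi^{-s/2}\Gamma(s/2)\zeta(s)$, with $\zeta$ the Riemann zeta function, and let $$K_s(x)=\tfrac12\int_0^\infty u^{s-1}e^{-\frac x2\left(u+\frac1u\right)}\,du\qquad(x>0,\ s\in\mathbb C)$$ be the modified Bessel function of the second kind. Then for every $s\in\mathbb C$ the series below converges absolutely (as a series over $j$), and $$\frac{s(s+1)}{32\pi^2\sqrt2}\left(2^{\frac s2}-2^{-\frac s2}\right)\left(2^{\frac{s-1}2}-2^{-\frac{s-1}2}\right)\zeta^*(s)\,\zeta^*(s+1)=\sum_{j=1}^\infty\ \sum_{d\mid j}a(d)\,b\!\left(\frac jd\right)\left(\frac j{d^2}\right)^{\frac s2}K_s\!\left(2\pi\sqrt j\right),$$ where at the points $s=1,0,-1,-2,\dots$, at which a factor on the left-hand side is not defined, the left-hand side is understood as its limit (these singularities are removable). -/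

import Mathlib

open Filter Topology

noncomputable section

/-- The multiplicative function with `a n = σ₁ n` for odd `n` and `a (2 ^ m) = 2 ^ m`:
`ordProj[2] n` is the largest power of `2` dividing `n`, `ordCompl[2] n` the odd part of `n`. -/
def coeffA (n : ℕ) : ℕ := ordProj[2] n * ArithmeticFunction.sigma 1 (ordCompl[2] n)

/-- The multiplicative function with `b n = σ₁ n` for odd `n` and `b (2 ^ m) = 0` for `m ≥ 1`. -/
def coeffB (n : ℕ) : ℕ := if Odd n then ArithmeticFunction.sigma 1 n else 0

/-- `ζ*(s) = π ^ (-s/2) Γ(s/2) ζ(s)`. -/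
def zetaStar (s : ℂ) : ℂ :=
  (Real.pi : ℂ) ^ (-s / 2) * Complex.Gamma (s / 2) * riemannZeta s

/-- The modified Bessel function of the second kind `K_s(x)`, for `x > 0` and complex order `s`:
`K_s(x) = (1/2) ∫_0^∞ u ^ (s - 1) exp (-(x/2) (u + 1/u)) du`. -/
def besselK (s : ℂ) (x : ℝ) : ℂ :=
  (1 / 2 : ℂ) * ∫ u in Set.Ioi (0 : ℝ),
    (u : ℂ) ^ (s - 1) * (Real.exp (-(x / 2) * (u + 1 / u)) : ℂ)

/-- The zeta side
`s(s+1)/(32π²√2) (2^{s/2} - 2^{-s/2}) (2^{(s-1)/2} - 2^{-(s-1)/2}) ζ*(s) ζ*(s+1)`. -/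
def zetaSide (s : ℂ) : ℂ :=
  s * (s + 1) / (32 * (Real.pi : ℂ) ^ 2 * (Real.sqrt 2 : ℂ))
    * ((2 : ℂ) ^ (s / 2) - (2 : ℂ) ^ (-s / 2))
    * ((2 : ℂ) ^ ((s - 1) / 2) - (2 : ℂ) ^ (-(s - 1) / 2))
    * zetaStar s * zetaStar (s + 1)

/-- The `j`-th term `∑_{d ∣ j} a(d) b(j/d) (j/d²)^{s/2} K_s(2π√j)` of the Bessel series. -/
def besselTerm (s : ℂ) (j : ℕ) : ℂ :=
  ∑ d ∈ j.divisors, (coeffA d : ℂ) * (coeffB (j / d) : ℂ)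
    * ((j : ℂ) / (d : ℂ) ^ 2) ^ (s / 2) * besselK s (2 * Real.pi * Real.sqrt j)

end

/-! The identity evaluates one Mellin transform in two ways. Let A(q) and B(q) be the generating
functions of a and b, and consider `productAB`, that is t ↦ A(e^{-πt}) B(e^{-π/t}).

Multiplying out, each a(d) b(e) exp(-π(dt + e/t)) has Mellin transform 2 a(d) b(e) (e/d)^{s/2}
K_s(2π√(de)), so grouping by j = de gives twice the Bessel series (`hasSum_besselTerm`). The
inequality dt + e/t ≥ 2√(de) gives bounds that justify the interchange for every s and make the
transform entire.

The product is also a single Lambert-type series. Let T be `eisTheta₄`, the Eisenstein series equal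
to θ₄⁴. Inversion turns B(e^{-π/t}) into t²/16 · T(it) (`sigmaGen_sub_inv`), while A is a constant
multiple of the logarithmic derivative of T. Hence A·T is a multiple of the derivative of T, a
combination of the series ∑ n σ₁(n) qⁿ at q, q², q⁴ (`sub_mul_eisTheta₄`). For Re s > 1 its Mellin
transform is a Gamma factor times (1 - 2^{-s})(1 - 2^{1-s}) ζ(s) ζ(s+1), which the duplication
formula turns into the zeta side. The identity theorem extends the equality, and continuity of the
entire side gives the limits.

The formula for the logarithmic derivative of T comes from T⁶ Δ(z) = Δ(z/2)²
(`eisTheta₄_pow_mul_disc`). The ratio of the two sides and its two conjugates are permuted by the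
modular group. The product of (ratio - 1) over the three is a level one form of weight 0 vanishing
at i∞, hence zero. -/

noncomputable section

open UpperHalfPlane hiding I
open Complex EisensteinSeries ModularForm MatrixGroups MeasureTheory
open scoped ArithmeticFunction.sigma Real

/-! ### Generating functions of σ₁, a and b -/

/-- The generating function `∑ σ₁(n) qⁿ` of the sum-of-divisors function. -/
def sigmaGen (q : ℂ) : ℂ := ∑' n : ℕ, (σ 1 n : ℂ) * q ^ n

/-- The generating function `∑ n σ₁(n) qⁿ`. -/
def sigmaGenDeriv (q : ℂ) : ℂ := ∑' n : ℕ, (n : ℂ) * (σ 1 n : ℂ) * q ^ n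

theorem sigma_one_le_sq (n : ℕ) : σ 1 n ≤ n ^ 2 := by
  simpa using ArithmeticFunction.sigma_le_pow_succ 1 n

theorem summable_norm_mul_pow_of_le {c : ℕ → ℂ} {k : ℕ} (hc : ∀ n, ‖c n‖ ≤ (n : ℝ) ^ k) {q : ℂ}
    (hq : ‖q‖ < 1) : Summable fun n : ℕ => ‖c n * q ^ n‖ := by
  refine (summable_norm_pow_mul_geometric_of_norm_lt_one k hq).of_nonneg_of_le
    (fun n => norm_nonneg _) fun n => ?_
  simp only [norm_mul, norm_pow, Complex.norm_natCast]
  gcongr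
  exact hc n

theorem norm_sigma_one_le (n : ℕ) : ‖(σ 1 n : ℂ)‖ ≤ (n : ℝ) ^ 2 := by
  rw [Complex.norm_natCast]
  exact_mod_cast sigma_one_le_sq n

theorem norm_mul_sigma_one_le (n : ℕ) : ‖(n : ℂ) * (σ 1 n : ℂ)‖ ≤ (n : ℝ) ^ 3 := by
  rw [norm_mul, Complex.norm_natCast, pow_succ']
  gcongr
  exact norm_sigma_one_le n

theorem hasSum_sigmaGen {q : ℂ} (hq : ‖q‖ < 1) :
    HasSum (fun n : ℕ => (σ 1 n : ℂ) * q ^ n) (sigmaGen q) :=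
  (summable_norm_mul_pow_of_le norm_sigma_one_le hq).of_norm.hasSum

theorem hasSum_sigmaGenDeriv {q : ℂ} (hq : ‖q‖ < 1) :
    HasSum (fun n : ℕ => (n : ℂ) * (σ 1 n : ℂ) * q ^ n) (sigmaGenDeriv q) :=
  (summable_norm_mul_pow_of_le norm_mul_sigma_one_le hq).of_norm.hasSum

theorem sigmaGen_zero : sigmaGen 0 = 0 := by
  rw [sigmaGen, tsum_eq_single 0] <;> simp +contextual

theorem exists_hasDerivAt_sigmaGen {q : ℂ} (hq : ‖q‖ < 1) :
    ∃ d, HasDerivAt sigmaGen d q ∧ q * d = sigmaGenDeriv q := by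
  obtain ⟨r, hqr, hr⟩ := exists_between hq
  have hr0 : 0 < r := (norm_nonneg q).trans_lt hqr
  have hu : Summable fun n : ℕ => (n : ℝ) ^ 3 * r ^ (n - 1) := by
    have := (summable_norm_pow_mul_geometric_of_norm_lt_one 3
      (r := r) (by rwa [Real.norm_of_nonneg hr0.le])).mul_left r⁻¹
    refine this.congr fun n => ?_
    rcases n with _ | n
    · simp
    · rw [Real.norm_of_nonneg (by positivity)]
      field_simp
      simp [pow_succ, mul_comm]
  have key := hasDerivAt_tsum_of_isPreconnected (𝕜 := ℂ) (F := ℂ) hu Metric.isOpen_ball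
    (convex_ball (0 : ℂ) r).isPreconnected
    (g := fun n w => (σ 1 n : ℂ) * w ^ n) (g' := fun n w => (σ 1 n : ℂ) * ((n : ℂ) * w ^ (n - 1)))
    (fun n w _ => (hasDerivAt_pow n w).const_mul _) (fun n w hw => ?_)
    (Metric.mem_ball_self hr0) (y := q) ?_ (by simpa using hqr)
  · refine ⟨_, key, ?_⟩
    rw [← tsum_mul_left, sigmaGenDeriv]
    refine tsum_congr fun n => ?_
    rcases n with _ | n
    · simp
    · simp only [Nat.add_sub_cancel, pow_succ]
      ring
  · have hw' : ‖w‖ ≤ r := by simpa using (Metric.mem_ball.1 hw).le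
    rw [← mul_assoc, norm_mul, norm_pow, mul_comm (σ 1 n : ℂ)]
    gcongr
    exact norm_mul_sigma_one_le n
  · exact (hasSum_sigmaGen (by simp)).summable

theorem differentiableAt_sigmaGen {q : ℂ} (hq : ‖q‖ < 1) : DifferentiableAt ℂ sigmaGen q :=
  let ⟨_, h, _⟩ := exists_hasDerivAt_sigmaGen hq
  h.differentiableAt

theorem sigmaGen_isBigO : sigmaGen =O[𝓝 0] fun q => q := by
  simpa [sigmaGen_zero] using (differentiableAt_sigmaGen (q := 0) (by simp)).isBigO_sub

theorem hasSum_ite_dvd {g : ℕ → ℂ} {a : ℂ} {k : ℕ} (hk : 0 < k) (h : HasSum g a) :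
    HasSum (fun n : ℕ => if k ∣ n then g (n / k) else 0) a := by
  have hinj : Function.Injective fun n : ℕ => k * n := fun a b h => Nat.eq_of_mul_eq_mul_left hk h
  rw [← hinj.hasSum_iff]
  · convert! h using 1
    ext n
    simp [Nat.mul_div_cancel_left n hk]
  · intro n hn
    exact if_neg fun ⟨m, hm⟩ => hn ⟨m, hm.symm⟩

theorem hasSum_mul_pow_of_hasSum_pow {c : ℕ → ℂ} {a q : ℂ} {k : ℕ} (hk : 0 < k)
    (h : HasSum (fun n => c n * (q ^ k) ^ n) a) :
    HasSum (fun n : ℕ => (if k ∣ n then c (n / k) else 0) * q ^ n) a := by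
  convert! hasSum_ite_dvd hk h using 2 with n
  split_ifs with hn
  · rw [← pow_mul, Nat.mul_div_cancel' hn]
  · rw [zero_mul]

theorem norm_pow_lt_one {q : ℂ} (hq : ‖q‖ < 1) {k : ℕ} (hk : 0 < k) : ‖q ^ k‖ < 1 := by
  rw [norm_pow]
  exact pow_lt_one₀ (norm_nonneg _) hq hk.ne'

theorem hasSum_sigmaGen_pow {k : ℕ} (hk : 0 < k) {q : ℂ} (hq : ‖q‖ < 1) :
    HasSum (fun n : ℕ => (if k ∣ n then (σ 1 (n / k) : ℂ) else 0) * q ^ n) (sigmaGen (q ^ k)) :=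
  hasSum_mul_pow_of_hasSum_pow (c := fun n => (σ 1 n : ℂ)) hk
    (hasSum_sigmaGen (norm_pow_lt_one hq hk))

theorem sigma_one_two_pow_mul (j : ℕ) {m : ℕ} (hm : Odd m) :
    σ 1 (2 ^ j * m) = (2 ^ (j + 1) - 1) * σ 1 m := by
  rw [ArithmeticFunction.isMultiplicative_sigma.map_mul_of_coprime
    ((Nat.coprime_two_left.2 hm).pow_left j), ArithmeticFunction.sigma_one_apply_prime_pow
    Nat.prime_two, Nat.geomSum_eq le_rfl]
  simp

/-- The Hecke recursion at the prime 2. For n = 2^k m with m odd, every term is σ₁(m) times an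
expression in 2^k. -/
theorem sigma_one_two_mul (n : ℕ) :
    σ 1 (2 * n) + (if 2 ∣ n then 2 * σ 1 (n / 2) else 0) = 3 * σ 1 n := by
  rcases eq_or_ne n 0 with rfl | hn
  · simp
  obtain ⟨k, m, hm, rfl⟩ := Nat.exists_eq_two_pow_mul_odd hn
  have hc := fun j => sigma_one_two_pow_mul j hm
  rcases k with _ | k
  · have h2 : ¬ 2 ∣ m := by simpa [← even_iff_two_dvd] using hm
    have := hc 1
    simp_all
  · have e1 : 2 * (2 ^ (k + 1) * m) = 2 ^ (k + 2) * m := by ring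
    have e2 : 2 ^ (k + 1) * m / 2 = 2 ^ k * m := by
      rw [pow_succ', mul_assoc]; simp
    rw [e1, e2, if_pos (Dvd.dvd.mul_right (dvd_pow_self 2 (by simp)) m), hc, hc, hc]
    -- Writing 2^k = x + 1 removes the truncated subtractions.
    obtain ⟨x, hx⟩ : ∃ x, 2 ^ k = x + 1 := ⟨2 ^ k - 1, by have := Nat.one_le_two_pow (n := k); omega⟩
    simp only [pow_succ, hx]
    have h1 : (x + 1) * 2 * 2 * 2 - 1 = 8 * x + 7 := by omega
    have h2 : (x + 1) * 2 - 1 = 2 * x + 1 := by omega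
    have h3 : (x + 1) * 2 * 2 - 1 = 4 * x + 3 := by omega
    rw [h1, h2, h3]
    ring

/-- At even n the right side vanishes by the Hecke recursion applied to n/2; at odd n only the first
term survives. -/
theorem coeffB_eq (n : ℕ) : (coeffB n : ℂ) = (σ 1 n : ℂ)
    - 3 * (if 2 ∣ n then (σ 1 (n / 2) : ℂ) else 0)
    + 2 * (if 4 ∣ n then (σ 1 (n / 4) : ℂ) else 0) := by
  by_cases hn : 2 ∣ n
  · obtain ⟨m, rfl⟩ := hn
    have h := congrArg (Nat.cast : ℕ → ℂ) (sigma_one_two_mul m)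
    have hodd : ¬ Odd (2 * m) := by simp
    have e4 : 4 ∣ 2 * m ↔ 2 ∣ m := by omega
    have e4' : 2 * m / 4 = m / 2 := by omega
    simp only [coeffB, if_neg hodd, e4, e4', dvd_mul_right, if_true,
      Nat.mul_div_cancel_left m two_pos]
    push_cast at h ⊢
    split_ifs at h ⊢ <;> linear_combination -h
  · have hodd : Odd n := by rwa [← Nat.not_even_iff_odd, even_iff_two_dvd]
    have h4 : ¬ 4 ∣ n := by omega
    simp [coeffB, hodd, hn, h4]

theorem coeffA_two_pow_mul (k : ℕ) {m : ℕ} (hm : Odd m) : coeffA (2 ^ k * m) = 2 ^ k * σ 1 m := by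
  have h2 : ¬ 2 ∣ m := by simpa [← even_iff_two_dvd] using hm
  have h := Nat.ordCompl_pow_mul_of_not_dvd k Nat.prime_two h2
  have h' := Nat.ordProj_mul_ordCompl_eq_self (2 ^ k * m) 2
  rw [h] at h'
  rw [coeffA, h, Nat.eq_of_mul_eq_mul_right hm.pos h']

theorem coeffA_eq (n : ℕ) :
    (coeffA n : ℂ) = (σ 1 n : ℂ) - (if 2 ∣ n then (σ 1 (n / 2) : ℂ) else 0) := by
  rcases eq_or_ne n 0 with rfl | hn
  · simp [coeffA]
  obtain ⟨k, m, hm, rfl⟩ := Nat.exists_eq_two_pow_mul_odd hn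
  rw [coeffA_two_pow_mul k hm]
  rcases k with _ | k
  · have h2 : ¬ 2 ∣ m := by simpa [← even_iff_two_dvd] using hm
    simp [h2]
  · have e2 : 2 ^ (k + 1) * m / 2 = 2 ^ k * m := by
      rw [pow_succ', mul_assoc]; simp
    rw [e2, if_pos (Dvd.dvd.mul_right (dvd_pow_self 2 (by simp)) m), sigma_one_two_pow_mul _ hm,
      sigma_one_two_pow_mul _ hm]
    push_cast [Nat.one_le_two_pow]
    ring

theorem hasSum_coeffA {q : ℂ} (hq : ‖q‖ < 1) :
    HasSum (fun n : ℕ => (coeffA n : ℂ) * q ^ n) (sigmaGen q - sigmaGen (q ^ 2)) := by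
  convert! (hasSum_sigmaGen hq).sub (hasSum_sigmaGen_pow two_pos hq) using 2 with n
  rw [coeffA_eq, sub_mul]

theorem hasSum_coeffB {q : ℂ} (hq : ‖q‖ < 1) : HasSum (fun n : ℕ => (coeffB n : ℂ) * q ^ n)
    (sigmaGen q - 3 * sigmaGen (q ^ 2) + 2 * sigmaGen (q ^ 4)) := by
  convert! ((hasSum_sigmaGen hq).sub ((hasSum_sigmaGen_pow two_pos hq).mul_left 3)).add
    ((hasSum_sigmaGen_pow four_pos hq).mul_left 2) using 2 with n
  rw [coeffB_eq]
  ring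

theorem hasSum_coeffB_of_neg {q : ℂ} (hq : ‖q‖ < 1) : HasSum (fun n : ℕ => (coeffB n : ℂ) * q ^ n)
    ((sigmaGen q - sigmaGen (-q)) / 2) := by
  convert! ((hasSum_sigmaGen hq).sub (hasSum_sigmaGen (q := -q) (by simpa using hq))).div_const 2
    using 2 with n
  rcases Nat.even_or_odd n with hn | hn
  · simp [coeffB, hn, hn.neg_pow]
  · simp only [coeffB, hn, if_true, hn.neg_pow]
    ring

/-- The odd part of the series has two expressions, one through q ↦ -q and one through the Hecke
recursion; they are compared here. -/
theorem sigmaGen_neg {q : ℂ} (hq : ‖q‖ < 1) :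
    sigmaGen (-q) = -sigmaGen q + 6 * sigmaGen (q ^ 2) - 4 * sigmaGen (q ^ 4) := by
  linear_combination -2 * (hasSum_coeffB_of_neg hq).unique (hasSum_coeffB hq)

theorem coeffA_le (n : ℕ) : coeffA n ≤ n ^ 2 := by
  refine le_trans ?_ (sigma_one_le_sq n)
  have := coeffA_eq n
  split_ifs at this with h
  · rw [eq_sub_iff_add_eq] at this
    norm_cast at this
    omega
  · rw [sub_zero] at this
    exact (by exact_mod_cast this : coeffA n = _).le

theorem coeffB_le (n : ℕ) : coeffB n ≤ n ^ 2 := by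
  rw [coeffB]
  split_ifs
  · exact sigma_one_le_sq n
  · exact Nat.zero_le _

/-! ### E₂ and Δ on the upper half plane -/

/-- The weight two Eisenstein series `E₂` as a function on `ℂ`. -/
def eisTwo (w : ℂ) : ℂ := E2 (ofComplex w)

/-- The modular discriminant as a function on `ℂ`. -/
def disc (w : ℂ) : ℂ := ModularForm.discriminant (ofComplex w)

theorem norm_cexp_two_pi_I_lt_one {w : ℂ} (hw : 0 < w.im) : ‖cexp (2 * π * I * w)‖ < 1 :=
  norm_exp_two_pi_I_lt_one ⟨w, hw⟩

theorem eisTwo_eq_sigmaGen {w : ℂ} (hw : 0 < w.im) :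
    eisTwo w = 1 - 24 * sigmaGen (cexp (2 * π * I * w)) := by
  rw [eisTwo, E2_eq_tsum_cexp, sigmaGen, ofComplex_apply_of_im_pos hw]
  congr 2
  rw [tsum_pnat_eq_tsum_succ (f := fun n : ℕ => (σ 1 n : ℂ) * cexp (2 * π * I * w) ^ n),
    (hasSum_sigmaGen (norm_cexp_two_pi_I_lt_one hw)).summable.tsum_eq_zero_add]
  simp

theorem im_neg_inv_pos {w : ℂ} (hw : 0 < w.im) : 0 < (-w⁻¹).im := by
  simpa [inv_neg] using UpperHalfPlane.im_inv_neg_coe_pos ⟨w, hw⟩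

theorem ne_zero_of_im_pos {w : ℂ} (hw : 0 < w.im) : w ≠ 0 := by
  rintro rfl
  simp at hw

theorem eisTwo_add_one {w : ℂ} (hw : 0 < w.im) : eisTwo (w + 1) = eisTwo w := by
  rw [eisTwo_eq_sigmaGen hw, eisTwo_eq_sigmaGen (by simpa using hw), mul_add, mul_one,
    Complex.exp_periodic]

theorem eisTwo_neg_inv {w : ℂ} (hw : 0 < w.im) :
    eisTwo (-w⁻¹) = w ^ 2 * eisTwo w + 6 * w / (π * I) := by
  have h := congrFun (E2_slash_action ModularGroup.S) ⟨w, hw⟩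
  have hw0 := ne_zero_of_im_pos hw
  simp only [SlashInvariantForm.slash_S_apply, Pi.sub_apply, Pi.smul_apply, D2_S, smul_eq_mul,
    riemannZeta_two] at h
  rw [eisTwo, eisTwo, ofComplex_apply_of_im_pos (im_neg_inv_pos hw), ofComplex_apply_of_im_pos hw]
  have e : (⟨(-w)⁻¹, by simpa [inv_neg] using im_neg_inv_pos hw⟩ : ℍ) =
    ⟨-w⁻¹, im_neg_inv_pos hw⟩ := by ext; simp [inv_neg]
  simp only [e] at h
  have hpi : (π : ℂ) ≠ 0 := by exact_mod_cast Real.pi_ne_zero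
  rw [zpow_neg, zpow_ofNat, ← div_eq_mul_inv, div_eq_iff (pow_ne_zero 2 hw0)] at h
  rw [h]
  field_simp
  linear_combination (-6) * I_sq

theorem disc_eq_prod {w : ℂ} (hw : 0 < w.im) : disc w =
    cexp (2 * π * I * w) * ∏' n : ℕ, (1 - cexp (2 * π * I * w) ^ (n + 1)) ^ 24 := by
  rw [disc, discriminant_eq_q_prod, ofComplex_apply_of_im_pos hw]
  simp [eta_q, Function.Periodic.qParam]

theorem disc_add_one {w : ℂ} (hw : 0 < w.im) : disc (w + 1) = disc w := by
  rw [disc_eq_prod hw, disc_eq_prod (by simpa using hw), mul_add, mul_one, Complex.exp_periodic]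

theorem disc_neg_inv {w : ℂ} (hw : 0 < w.im) : disc (-w⁻¹) = w ^ 12 * disc w := by
  have h := congrFun discriminant_S_invariant ⟨w, hw⟩
  have hw0 := ne_zero_of_im_pos hw
  simp only [SlashInvariantForm.slash_S_apply] at h
  rw [disc, disc, ofComplex_apply_of_im_pos (im_neg_inv_pos hw), ofComplex_apply_of_im_pos hw]
  have e : (⟨(-w)⁻¹, by simpa [inv_neg] using im_neg_inv_pos hw⟩ : ℍ) =
    ⟨-w⁻¹, im_neg_inv_pos hw⟩ := by ext; simp [inv_neg]
  simp only [e] at h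
  rw [zpow_neg, zpow_ofNat, ← div_eq_mul_inv, div_eq_iff (pow_ne_zero 12 hw0)] at h
  rw [h, mul_comm]

theorem disc_ne_zero (w : ℂ) : disc w ≠ 0 := discriminant_ne_zero _

theorem disc_eq_eta_pow {w : ℂ} (hw : 0 < w.im) : disc w = ModularForm.eta w ^ 24 := by
  rw [disc, ofComplex_apply_of_im_pos hw, ModularForm.discriminant]

theorem hasDerivAt_disc {w : ℂ} (hw : 0 < w.im) :
    HasDerivAt disc (2 * π * I * eisTwo w * disc w) w := by
  have h1 := (differentiableAt_eta_of_mem_upperHalfPlaneSet hw).hasDerivAt.pow 24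
  have h2 := logDeriv_eta_eq_E2 ⟨w, hw⟩
  rw [logDeriv_apply, div_eq_iff (eta_ne_zero hw)] at h2
  refine (h1.congr_of_eventuallyEq ?_).congr_deriv ?_
  · filter_upwards [isOpen_upperHalfPlaneSet.mem_nhds hw] with z hz
    exact disc_eq_eta_pow hz
  · simp only at h2
    rw [h2, disc_eq_eta_pow hw, eisTwo, ofComplex_apply_of_im_pos hw]
    push_cast
    ring

theorem differentiableAt_eisTwo {w : ℂ} (hw : 0 < w.im) : DifferentiableAt ℂ eisTwo w :=
  ((UpperHalfPlane.mdifferentiable_iff.1 E2_mdifferentiable) w hw).differentiableAt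
    (isOpen_upperHalfPlaneSet.mem_nhds hw)

/-! ### Rigidity in level one and limits at i∞ -/

/-- A holomorphic function on the upper half plane, invariant under `z ↦ z + 1` and `z ↦ -1 / z`
and tending to zero at `i∞`, vanishes. -/
theorem eq_zero_of_invariant_of_tendsto_zero {P : ℂ → ℂ}
    (hd : ∀ z : ℂ, 0 < z.im → DifferentiableAt ℂ P z)
    (hT : ∀ z : ℂ, 0 < z.im → P (z + 1) = P z) (hS : ∀ z : ℂ, 0 < z.im → P (-z⁻¹) = P z)
    (h0 : Tendsto P (comap Complex.im atTop) (𝓝 0)) {z : ℂ} (hz : 0 < z.im) : P z = 0 := by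
  have hS' : (fun z : ℍ => P z) ∣[(0 : ℤ)] ModularGroup.S = fun z : ℍ => P z := by
    ext z
    rw [SlashInvariantForm.slash_S_apply]
    simpa [inv_neg] using hS z z.im_pos
  have hT' : (fun z : ℍ => P z) ∣[(0 : ℤ)] ModularGroup.T = fun z : ℍ => P z := by
    ext z
    rw [SL_slash_apply, modular_T_smul]
    simpa [add_comm] using hT z z.im_pos
  have hinv := SlashInvariantForm.slash_action_generators_SL2Z hS' hT'
  have hlim : Tendsto (fun z : ℍ => P z) atImInfty (𝓝 0) := h0.comp tendsto_coe_atImInfty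
  let F : ModularForm 𝒮ℒ 0 :=
    { toFun := fun z => P z
      slash_action_eq' := by
        rintro _ ⟨A, rfl⟩
        exact hinv A
      holo' := by
        rw [UpperHalfPlane.mdifferentiable_iff]
        refine .congr (fun z hz => (hd z hz).differentiableWithinAt) fun z hz => ?_
        simp [ofComplex_apply_of_im_pos hz]
      bdd_at_cusps' := by
        intro c hc
        rw [OnePoint.isBoundedAt_iff_forall_SL2Z hc]
        intro γ _
        rw [hinv]
        exact hlim.isBigO_one ℝ }
  -- A level one form of weight 0 is constant, and the limit at the cusp identifies the constant as
  -- 0.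
  obtain ⟨c, hc⟩ := ModularFormClass.levelOne_weight_zero_const F
  have hc' : ∀ z : ℍ, P z = c := fun z => congrFun hc z
  have : c = 0 := tendsto_nhds_unique (tendsto_const_nhds.congr fun z => (hc' z).symm) hlim
  rw [← this]
  exact hc' ⟨z, hz⟩

theorem tendsto_comap_im_of_im_eq {f : ℂ → ℂ} {c : ℝ} (hc : 0 < c)
    (hf : ∀ z, (f z).im = c * z.im) :
    Tendsto f (comap Complex.im atTop) (comap Complex.im atTop) := by
  rw [tendsto_comap_iff]
  have : Complex.im ∘ f = (fun x => c * x) ∘ Complex.im := funext hf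
  rw [this]
  exact (tendsto_id.const_mul_atTop hc).comp tendsto_comap

theorem tendsto_div_two :
    Tendsto (fun z : ℂ => z / 2) (comap Complex.im atTop) (comap Complex.im atTop) :=
  tendsto_comap_im_of_im_eq (c := 1 / 2) (by norm_num) fun z => by
    rw [show z / 2 = ((1 / 2 : ℝ) : ℂ) * z by push_cast; ring, im_ofReal_mul]

theorem tendsto_add_one_div_two :
    Tendsto (fun z : ℂ => (z + 1) / 2) (comap Complex.im atTop) (comap Complex.im atTop) :=
  tendsto_comap_im_of_im_eq (c := 1 / 2) (by norm_num) fun z => by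
    rw [show (z + 1) / 2 = ((1 / 2 : ℝ) : ℂ) * (z + 1) by push_cast; ring, im_ofReal_mul]
    simp

theorem tendsto_two_mul :
    Tendsto (fun z : ℂ => 2 * z) (comap Complex.im atTop) (comap Complex.im atTop) :=
  tendsto_comap_im_of_im_eq (c := 2) (by norm_num) fun z => by simp

theorem tendsto_cexp_two_pi_I :
    Tendsto (fun w : ℂ => cexp (2 * π * I * w)) (comap Complex.im atTop) (𝓝 0) := by
  have := (Function.Periodic.qParam_tendsto one_pos).mono_right nhdsWithin_le_nhds
  refine this.congr fun w => ?_
  simp [Function.Periodic.qParam]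

theorem eventually_im_pos : ∀ᶠ z : ℂ in comap Complex.im atTop, 0 < z.im :=
  tendsto_comap.eventually (eventually_gt_atTop 0)

theorem tendsto_eisTwo : Tendsto eisTwo (comap Complex.im atTop) (𝓝 1) := by
  have h1 : Tendsto (fun w => 1 - 24 * sigmaGen (cexp (2 * π * I * w))) (comap Complex.im atTop)
      (𝓝 (1 - 24 * sigmaGen 0)) :=
    ((((differentiableAt_sigmaGen (q := 0) (by simp)).continuousAt.tendsto).comp
      tendsto_cexp_two_pi_I).const_mul 24).const_sub 1
  rw [sigmaGen_zero, mul_zero, sub_zero] at h1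
  refine h1.congr' ?_
  filter_upwards [eventually_im_pos] with w hw
  rw [eisTwo_eq_sigmaGen hw]

theorem tendsto_disc_div_cexp :
    Tendsto (fun w => disc w / cexp (2 * π * I * w)) (comap Complex.im atTop) (𝓝 1) := by
  refine (tendsto_atImInfty_tprod_one_sub_eta_q_pow.comp tendsto_comap_im_ofComplex).congr' ?_
  filter_upwards [eventually_im_pos] with w hw
  rw [disc_eq_prod hw, mul_div_cancel_left₀ _ (exp_ne_zero _), Function.comp_apply,
    ofComplex_apply_of_im_pos hw]
  simp [eta_q, Function.Periodic.qParam]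

/-! ### Three weight two Eisenstein series and their transformations -/

/-- The weight two Eisenstein series equal to `θ₄⁴`. -/
def eisTheta₄ (z : ℂ) : ℂ := (4 * eisTwo (2 * z) - eisTwo ((z + 1) / 2)) / 3

/-- The weight two Eisenstein series equal to `-θ₂⁴`. -/
def eisTheta₂ (z : ℂ) : ℂ := (eisTwo (z / 2) - eisTwo ((z + 1) / 2)) / 3

/-- The weight two Eisenstein series equal to `θ₃⁴`. -/
def eisTheta₃ (z : ℂ) : ℂ := (4 * eisTwo (2 * z) - eisTwo (z / 2)) / 3

theorem im_div_two_pos {z : ℂ} (hz : 0 < z.im) : 0 < (z / 2).im := by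
  rw [show z / 2 = ((1 / 2 : ℝ) : ℂ) * z by push_cast; ring, im_ofReal_mul]
  positivity

theorem im_add_one_div_two_pos {z : ℂ} (hz : 0 < z.im) : 0 < ((z + 1) / 2).im :=
  im_div_two_pos (by simpa using hz)

theorem im_two_mul_pos {z : ℂ} (hz : 0 < z.im) : 0 < (2 * z).im := by simpa using hz

/-- Inversion permutes 4E₂(2z), E₂(z/2) and E₂((z+1)/2) up to the factor z², always with the same
anomaly 12z/(πi). Differences of them are therefore genuinely modular. -/
theorem eisTwo_two_mul_neg_inv {z : ℂ} (hz : 0 < z.im) :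
    4 * eisTwo (2 * -z⁻¹) = z ^ 2 * eisTwo (z / 2) + 12 * z / (π * I) := by
  rw [show 2 * -z⁻¹ = -(z / 2)⁻¹ by rw [inv_div]; ring, eisTwo_neg_inv (im_div_two_pos hz)]
  ring

theorem eisTwo_neg_inv_div_two {z : ℂ} (hz : 0 < z.im) :
    eisTwo (-z⁻¹ / 2) = z ^ 2 * (4 * eisTwo (2 * z)) + 12 * z / (π * I) := by
  rw [show -z⁻¹ / 2 = -(2 * z)⁻¹ by rw [mul_inv]; ring, eisTwo_neg_inv (im_two_mul_pos hz)]
  ring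

/-- The right side is the word S T⁻² S T⁻¹ applied to (z+1)/2, so only the two generators'
transformation laws are needed. -/
theorem neg_inv_add_one_div_two {z : ℂ} (hz : 0 < z.im) :
    (-z⁻¹ + 1) / 2 = -(-((z + 1) / 2 - 1)⁻¹ - 2)⁻¹ := by
  have h0 := ne_zero_of_im_pos hz
  have h1 : z - 1 ≠ 0 := ne_zero_of_im_pos (by simpa using hz)
  have e1 : (z + 1) / 2 - 1 = (z - 1) / 2 := by ring
  have e2 : -((z - 1) / 2)⁻¹ - 2 = -(2 * z / (z - 1)) := by
    field_simp
    ring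
  rw [e1, e2, inv_neg, neg_neg, inv_div]
  field_simp
  ring

theorem eisTwo_neg_inv_add_one_div_two {z : ℂ} (hz : 0 < z.im) :
    eisTwo ((-z⁻¹ + 1) / 2) = z ^ 2 * eisTwo ((z + 1) / 2) + 12 * z / (π * I) := by
  have h1 : z - 1 ≠ 0 := ne_zero_of_im_pos (by simpa using hz)
  have hpi : (π : ℂ) ≠ 0 := by exact_mod_cast Real.pi_ne_zero
  have hw := im_add_one_div_two_pos hz
  have hw1 : 0 < ((z + 1) / 2 - 1).im := by simpa using hw
  have hp := im_neg_inv_pos hw1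
  have hp1 : 0 < (-((z + 1) / 2 - 1)⁻¹ - 1).im := by simpa using hp
  have hp2 : 0 < (-((z + 1) / 2 - 1)⁻¹ - 2).im := by simpa using hp
  rw [neg_inv_add_one_div_two hz, eisTwo_neg_inv hp2, ← eisTwo_add_one hp2,
    show -((z + 1) / 2 - 1)⁻¹ - 2 + 1 = -((z + 1) / 2 - 1)⁻¹ - 1 by ring, ← eisTwo_add_one hp1,
    sub_add_cancel, eisTwo_neg_inv hw1, ← eisTwo_add_one hw1, sub_add_cancel]
  have e1 : (z + 1) / 2 - 1 = (z - 1) / 2 := by ring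
  have e2 : -((z - 1) / 2)⁻¹ - 2 = -(2 * z / (z - 1)) := by
    field_simp
    ring
  rw [e1, e2]
  field_simp
  ring

theorem disc_neg_inv_add_one_div_two {z : ℂ} (hz : 0 < z.im) :
    disc ((-z⁻¹ + 1) / 2) = z ^ 12 * disc ((z + 1) / 2) := by
  have h1 : z - 1 ≠ 0 := ne_zero_of_im_pos (by simpa using hz)
  have hw := im_add_one_div_two_pos hz
  have hw1 : 0 < ((z + 1) / 2 - 1).im := by simpa using hw
  have hp := im_neg_inv_pos hw1
  have hp1 : 0 < (-((z + 1) / 2 - 1)⁻¹ - 1).im := by simpa using hp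
  have hp2 : 0 < (-((z + 1) / 2 - 1)⁻¹ - 2).im := by simpa using hp
  rw [neg_inv_add_one_div_two hz, disc_neg_inv hp2, ← disc_add_one hp2,
    show -((z + 1) / 2 - 1)⁻¹ - 2 + 1 = -((z + 1) / 2 - 1)⁻¹ - 1 by ring, ← disc_add_one hp1,
    sub_add_cancel, disc_neg_inv hw1, ← disc_add_one hw1, sub_add_cancel]
  have e1 : (z + 1) / 2 - 1 = (z - 1) / 2 := by ring
  have e2 : -((z - 1) / 2)⁻¹ - 2 = -(2 * z / (z - 1)) := by
    field_simp
    ring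
  rw [e1, e2]
  field_simp

theorem disc_two_mul_neg_inv {z : ℂ} (hz : 0 < z.im) :
    2 ^ 12 * disc (2 * -z⁻¹) = z ^ 12 * disc (z / 2) := by
  rw [show 2 * -z⁻¹ = -(z / 2)⁻¹ by rw [inv_div]; ring, disc_neg_inv (im_div_two_pos hz)]
  ring

theorem disc_neg_inv_div_two {z : ℂ} (hz : 0 < z.im) :
    disc (-z⁻¹ / 2) = z ^ 12 * (2 ^ 12 * disc (2 * z)) := by
  rw [show -z⁻¹ / 2 = -(2 * z)⁻¹ by rw [mul_inv]; ring, disc_neg_inv (im_two_mul_pos hz)]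
  ring

theorem eisTheta₄_neg_inv {z : ℂ} (hz : 0 < z.im) :
    eisTheta₄ (-z⁻¹) = z ^ 2 * eisTheta₂ z := by
  rw [eisTheta₄, eisTheta₂, eisTwo_two_mul_neg_inv hz, eisTwo_neg_inv_add_one_div_two hz]
  ring

theorem eisTheta₂_neg_inv {z : ℂ} (hz : 0 < z.im) :
    eisTheta₂ (-z⁻¹) = z ^ 2 * eisTheta₄ z := by
  rw [eisTheta₄, eisTheta₂, eisTwo_neg_inv_div_two hz, eisTwo_neg_inv_add_one_div_two hz]
  ring

/-- The minus sign is harmless: only the sixth power enters the ratios below. -/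
theorem eisTheta₃_neg_inv {z : ℂ} (hz : 0 < z.im) :
    eisTheta₃ (-z⁻¹) = -(z ^ 2 * eisTheta₃ z) := by
  rw [eisTheta₃, eisTheta₃, eisTwo_neg_inv_div_two hz, eisTwo_two_mul_neg_inv hz]
  ring

theorem eisTwo_two_mul_add_one {z : ℂ} (hz : 0 < z.im) :
    eisTwo (2 * (z + 1)) = eisTwo (2 * z) := by
  have h2 := im_two_mul_pos hz
  rw [show 2 * (z + 1) = 2 * z + 1 + 1 by ring, eisTwo_add_one (by simpa using hz),
    eisTwo_add_one h2]

theorem eisTwo_add_one_add_one_div_two {z : ℂ} (hz : 0 < z.im) :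
    eisTwo ((z + 1 + 1) / 2) = eisTwo (z / 2) := by
  rw [show (z + 1 + 1) / 2 = z / 2 + 1 by ring, eisTwo_add_one (im_div_two_pos hz)]

theorem disc_two_mul_add_one {z : ℂ} (hz : 0 < z.im) : disc (2 * (z + 1)) = disc (2 * z) := by
  have h2 := im_two_mul_pos hz
  rw [show 2 * (z + 1) = 2 * z + 1 + 1 by ring, disc_add_one (by simpa using hz),
    disc_add_one h2]

theorem disc_add_one_add_one_div_two {z : ℂ} (hz : 0 < z.im) :
    disc ((z + 1 + 1) / 2) = disc (z / 2) := by
  rw [show (z + 1 + 1) / 2 = z / 2 + 1 by ring, disc_add_one (im_div_two_pos hz)]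

/-! ### The eta quotient for θ₄⁴ and its logarithmic derivative -/

/-- The ratio of `eisTheta₄ ^ 6` and `(η(z/2)⁸ / η(z)⁴) ^ 6`. -/
def thetaRatio₄ (z : ℂ) : ℂ := eisTheta₄ z ^ 6 * disc z / disc (z / 2) ^ 2

/-- The ratio of `eisTheta₂ ^ 6` and `(16 η(2z)⁸ / η(z)⁴) ^ 6`. -/
def thetaRatio₂ (z : ℂ) : ℂ := eisTheta₂ z ^ 6 * disc z / (2 ^ 12 * disc (2 * z)) ^ 2

/-- The ratio of `eisTheta₃ ^ 6` and `(η((z+1)/2)⁸ / η(z)⁴) ^ 6`, up to a root of unity. -/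
def thetaRatio₃ (z : ℂ) : ℂ := eisTheta₃ z ^ 6 * disc z / disc ((z + 1) / 2) ^ 2

theorem thetaRatio₄_neg_inv {z : ℂ} (hz : 0 < z.im) : thetaRatio₄ (-z⁻¹) = thetaRatio₂ z := by
  have h0 := ne_zero_of_im_pos hz
  have h1 := disc_ne_zero (2 * z)
  rw [thetaRatio₄, thetaRatio₂, eisTheta₄_neg_inv hz, disc_neg_inv_div_two hz, disc_neg_inv hz]
  field_simp

theorem thetaRatio₂_neg_inv {z : ℂ} (hz : 0 < z.im) : thetaRatio₂ (-z⁻¹) = thetaRatio₄ z := by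
  have h0 := ne_zero_of_im_pos hz
  have h1 := disc_ne_zero (z / 2)
  rw [thetaRatio₄, thetaRatio₂, eisTheta₂_neg_inv hz, disc_two_mul_neg_inv hz, disc_neg_inv hz]
  field_simp

theorem thetaRatio₃_neg_inv {z : ℂ} (hz : 0 < z.im) : thetaRatio₃ (-z⁻¹) = thetaRatio₃ z := by
  have h0 := ne_zero_of_im_pos hz
  have h1 := disc_ne_zero ((z + 1) / 2)
  rw [thetaRatio₃, thetaRatio₃, eisTheta₃_neg_inv hz, disc_neg_inv_add_one_div_two hz,
    disc_neg_inv hz]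
  field_simp

theorem thetaRatio₄_add_one {z : ℂ} (hz : 0 < z.im) : thetaRatio₄ (z + 1) = thetaRatio₃ z := by
  rw [thetaRatio₄, thetaRatio₃, eisTheta₄, eisTheta₃, disc_add_one hz, eisTwo_two_mul_add_one hz,
    eisTwo_add_one_add_one_div_two hz]

theorem thetaRatio₃_add_one {z : ℂ} (hz : 0 < z.im) : thetaRatio₃ (z + 1) = thetaRatio₄ z := by
  rw [thetaRatio₄, thetaRatio₃, eisTheta₄, eisTheta₃, disc_add_one hz, eisTwo_two_mul_add_one hz,
    disc_add_one_add_one_div_two hz]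

theorem thetaRatio₂_add_one {z : ℂ} (hz : 0 < z.im) : thetaRatio₂ (z + 1) = thetaRatio₂ z := by
  rw [thetaRatio₂, thetaRatio₂, eisTheta₂, eisTheta₂, disc_add_one hz, disc_two_mul_add_one hz,
    eisTwo_add_one_add_one_div_two hz]
  ring

theorem tendsto_eisTheta₄ : Tendsto eisTheta₄ (comap Complex.im atTop) (𝓝 1) := by
  have := (((tendsto_eisTwo.comp tendsto_two_mul).const_mul 4).sub
    (tendsto_eisTwo.comp tendsto_add_one_div_two)).div_const 3
  norm_num at this
  exact this

theorem tendsto_eisTheta₃ : Tendsto eisTheta₃ (comap Complex.im atTop) (𝓝 1) := by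
  have := (((tendsto_eisTwo.comp tendsto_two_mul).const_mul 4).sub
    (tendsto_eisTwo.comp tendsto_div_two)).div_const 3
  norm_num at this
  exact this

theorem cexp_add_one_div_two (z : ℂ) :
    cexp (2 * π * I * ((z + 1) / 2)) = -cexp (2 * π * I * (z / 2)) := by
  rw [show 2 * π * I * ((z + 1) / 2) = 2 * π * I * (z / 2) + π * I by ring, exp_add, exp_pi_mul_I]
  ring

theorem cexp_eq_sq (z : ℂ) : cexp (2 * π * I * z) = cexp (2 * π * I * (z / 2)) ^ 2 := by
  rw [← exp_nat_mul]
  congr 1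
  push_cast
  ring

theorem tendsto_thetaRatio₄ : Tendsto thetaRatio₄ (comap Complex.im atTop) (𝓝 1) := by
  have h := ((tendsto_eisTheta₄.pow 6).mul tendsto_disc_div_cexp).div
    ((tendsto_disc_div_cexp.comp tendsto_div_two).pow 2) (by norm_num)
  norm_num at h
  refine h.congr fun z => ?_
  have := exp_ne_zero (2 * π * I * (z / 2))
  have h1 := disc_ne_zero (z / 2)
  simp only [Pi.div_apply, thetaRatio₄]
  rw [cexp_eq_sq z]
  field_simp

theorem tendsto_thetaRatio₃ : Tendsto thetaRatio₃ (comap Complex.im atTop) (𝓝 1) := by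
  have h := ((tendsto_eisTheta₃.pow 6).mul tendsto_disc_div_cexp).div
    ((tendsto_disc_div_cexp.comp tendsto_add_one_div_two).pow 2) (by norm_num)
  norm_num at h
  refine h.congr fun z => ?_
  have := exp_ne_zero (2 * π * I * (z / 2))
  have h1 := disc_ne_zero ((z + 1) / 2)
  simp only [Pi.div_apply, thetaRatio₃]
  rw [cexp_eq_sq z, cexp_add_one_div_two]
  field_simp

theorem eisTheta₂_eq {z : ℂ} (hz : 0 < z.im) : eisTheta₂ z =
    -8 * (sigmaGen (cexp (2 * π * I * (z / 2))) - sigmaGen (-cexp (2 * π * I * (z / 2)))) := by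
  rw [eisTheta₂, eisTwo_eq_sigmaGen (im_div_two_pos hz),
    eisTwo_eq_sigmaGen (im_add_one_div_two_pos hz), cexp_add_one_div_two]
  ring

theorem eisTheta₂_isBigO :
    eisTheta₂ =O[comap Complex.im atTop] fun z => cexp (2 * π * I * (z / 2)) := by
  have hx : Tendsto (fun z : ℂ => cexp (2 * π * I * (z / 2))) (comap Complex.im atTop) (𝓝 0) :=
    tendsto_cexp_two_pi_I.comp tendsto_div_two
  have h1 := sigmaGen_isBigO.comp_tendsto hx
  have h2 := sigmaGen_isBigO.comp_tendsto (by simpa using hx.neg)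
  refine ((h1.sub (h2.trans ?_)).const_mul_left (-8)).congr' ?_ .rfl
  · exact (Asymptotics.isBigO_refl _ _).neg_left
  · filter_upwards [eventually_im_pos] with z hz
    rw [eisTheta₂_eq hz]
    rfl

/-- With x = e^{πiz}, the numerator is O(x⁶ · x²) and the denominator is of exact order (x⁴)² = x⁸.
Boundedness suffices here, because the other two factors in the product tend to 0. -/
theorem thetaRatio₂_isBigO : thetaRatio₂ =O[comap Complex.im atTop] fun _ => (1 : ℂ) := by
  have h1 : (fun z => eisTheta₂ z / cexp (2 * π * I * (z / 2))) =O[comap Complex.im atTop]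
      fun _ => (1 : ℂ) := by
    refine (eisTheta₂_isBigO.mul (Asymptotics.isBigO_refl
      (fun z : ℂ => (cexp (2 * π * I * (z / 2)))⁻¹) _)).congr (fun z => rfl) fun z => ?_
    exact mul_inv_cancel₀ (exp_ne_zero _)
  have h2 := (tendsto_disc_div_cexp.div (((tendsto_disc_div_cexp.comp tendsto_two_mul).const_mul
    (2 ^ 12)).pow 2) (by norm_num)).isBigO_one ℂ
  refine ((h1.pow 6).mul h2).congr (fun z => ?_) (fun z => by simp)
  have := exp_ne_zero (2 * π * I * (z / 2))
  have h1 := disc_ne_zero (2 * z)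
  simp only [Pi.div_apply, Function.comp_apply, thetaRatio₂]
  rw [cexp_eq_sq (2 * z), mul_div_cancel_left₀ z two_ne_zero, cexp_eq_sq z]
  field_simp

theorem differentiableAt_eisTwo_comp {f : ℂ → ℂ} {z : ℂ} (hf : DifferentiableAt ℂ f z)
    (h : 0 < (f z).im) : DifferentiableAt ℂ (fun z => eisTwo (f z)) z :=
  (differentiableAt_eisTwo h).comp z hf

theorem differentiableAt_disc_comp {f : ℂ → ℂ} {z : ℂ} (hf : DifferentiableAt ℂ f z)
    (h : 0 < (f z).im) : DifferentiableAt ℂ (fun z => disc (f z)) z :=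
  (hasDerivAt_disc h).differentiableAt.comp z hf

theorem differentiableAt_eisTheta₄ {z : ℂ} (hz : 0 < z.im) : DifferentiableAt ℂ eisTheta₄ z :=
  (((differentiableAt_eisTwo_comp (by fun_prop) (im_two_mul_pos hz)).const_mul 4).sub
    (differentiableAt_eisTwo_comp (by fun_prop) (im_add_one_div_two_pos hz))).div_const 3

theorem differentiableAt_thetaRatio₄ {z : ℂ} (hz : 0 < z.im) :
    DifferentiableAt ℂ thetaRatio₄ z := by
  have h1 := differentiableAt_eisTheta₄ hz
  have h2 := (hasDerivAt_disc hz).differentiableAt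
  have h3 := differentiableAt_disc_comp (f := fun z => z / 2) (by fun_prop) (im_div_two_pos hz)
  unfold thetaRatio₄
  exact ((h1.fun_pow 6).fun_mul h2).fun_div (h3.fun_pow 2) (pow_ne_zero 2 (disc_ne_zero _))

theorem differentiableAt_thetaRatio₃ {z : ℂ} (hz : 0 < z.im) :
    DifferentiableAt ℂ thetaRatio₃ z := by
  have h := (differentiableAt_thetaRatio₄ (z := z + 1) (by simpa using hz)).comp z
    (f := fun z => z + 1) (by fun_prop)
  refine h.congr_of_eventuallyEq ?_
  filter_upwards [isOpen_upperHalfPlaneSet.mem_nhds hz] with w hw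
  exact (thetaRatio₄_add_one hw).symm

theorem differentiableAt_thetaRatio₂ {z : ℂ} (hz : 0 < z.im) :
    DifferentiableAt ℂ thetaRatio₂ z := by
  have h := (differentiableAt_thetaRatio₄ (im_neg_inv_pos hz)).comp z
    (f := fun z => -z⁻¹) (differentiableAt_inv (ne_zero_of_im_pos hz)).neg
  refine h.congr_of_eventuallyEq ?_
  filter_upwards [isOpen_upperHalfPlaneSet.mem_nhds hz] with w hw
  exact (thetaRatio₄_neg_inv hw).symm

/-- Translation swaps the ratios 4 and 3, inversion swaps 4 and 2, and the remaining ratio is fixed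
each time, so the symmetric product is invariant under both generators. -/
theorem prod_thetaRatio_sub_one_eq_zero {z : ℂ} (hz : 0 < z.im) :
    (thetaRatio₄ z - 1) * (thetaRatio₂ z - 1) * (thetaRatio₃ z - 1) = 0 := by
  refine eq_zero_of_invariant_of_tendsto_zero
    (P := fun z => (thetaRatio₄ z - 1) * (thetaRatio₂ z - 1) * (thetaRatio₃ z - 1))
    (fun z hz => ?_) (fun z hz => ?_) (fun z hz => ?_) ?_ hz
  · exact (((differentiableAt_thetaRatio₄ hz).sub_const 1).mul
      ((differentiableAt_thetaRatio₂ hz).sub_const 1)).mul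
      ((differentiableAt_thetaRatio₃ hz).sub_const 1)
  · simp only [thetaRatio₄_add_one hz, thetaRatio₂_add_one hz, thetaRatio₃_add_one hz]
    ring
  · simp only [thetaRatio₄_neg_inv hz, thetaRatio₂_neg_inv hz, thetaRatio₃_neg_inv hz]
    ring
  · have h4 := (tendsto_thetaRatio₄.sub_const 1)
    have h3 := (tendsto_thetaRatio₃.sub_const 1)
    have h2 := thetaRatio₂_isBigO.sub (Asymptotics.isBigO_refl (fun _ => (1 : ℂ))
      (comap Complex.im atTop))
    rw [sub_self] at h3 h4
    have h := (((Asymptotics.isLittleO_one_iff ℂ).2 h4).mul_isBigO h2).mul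
      ((Asymptotics.isLittleO_one_iff ℂ).2 h3)
    simpa only [mul_one, Asymptotics.isLittleO_one_iff] using h

/-- By the identity theorem on the connected half plane one of the three factors vanishes
identically; a translation or inversion carries that to the ratio 4. -/
theorem thetaRatio₄_eq_one {z : ℂ} (hz : 0 < z.im) : thetaRatio₄ z = 1 := by
  have hconn : IsPreconnected upperHalfPlaneSet := (convex_halfSpace_im_gt 0).isPreconnected
  have han {f : ℂ → ℂ} (hf : ∀ z : ℂ, 0 < z.im → DifferentiableAt ℂ f z) :
      AnalyticOnNhd ℂ (fun z => f z - 1) upperHalfPlaneSet :=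
    DifferentiableOn.analyticOnNhd
      (fun z hz => ((hf z hz).sub_const 1).differentiableWithinAt) isOpen_upperHalfPlaneSet
  have h4 := han fun z => differentiableAt_thetaRatio₄
  have h3 := han fun z => differentiableAt_thetaRatio₃
  have h2 := han fun z => differentiableAt_thetaRatio₂
  rcases (h4.mul h2).eq_zero_or_eq_zero_of_mul_eq_zero h3
    (fun z hz => prod_thetaRatio_sub_one_eq_zero hz) hconn with h | h
  · rcases h4.eq_zero_or_eq_zero_of_mul_eq_zero h2 h hconn with h | h
    · exact sub_eq_zero.1 (h z hz)
    · rw [← thetaRatio₂_neg_inv hz]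
      exact sub_eq_zero.1 (h _ (im_neg_inv_pos hz))
  · rw [← thetaRatio₃_add_one hz]
    exact sub_eq_zero.1 (h (z + 1) (by simpa using hz))

theorem eisTheta₄_pow_mul_disc {z : ℂ} (hz : 0 < z.im) :
    eisTheta₄ z ^ 6 * disc z = disc (z / 2) ^ 2 := by
  have h := thetaRatio₄_eq_one hz
  rwa [thetaRatio₄, div_eq_one_iff_eq (pow_ne_zero 2 (disc_ne_zero _))] at h

/-- Logarithmic differentiation of T⁶ Δ(z) = Δ(z/2)², where Δ'/Δ = 2πi E₂. T has no zeros because Δ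
has none. -/
theorem hasDerivAt_eisTheta₄ {z : ℂ} (hz : 0 < z.im) :
    HasDerivAt eisTheta₄ (π * I / 3 * (eisTwo (z / 2) - eisTwo z) * eisTheta₄ z) z := by
  obtain ⟨d, hd⟩ : ∃ d, HasDerivAt eisTheta₄ d z := ⟨_, (differentiableAt_eisTheta₄ hz).hasDerivAt⟩
  have h1 := (hd.pow 6).mul (hasDerivAt_disc hz)
  have h2 := ((hasDerivAt_disc (im_div_two_pos hz)).comp z ((hasDerivAt_id z).div_const 2)).pow 2
  have h3 := h1.unique (h2.congr_of_eventuallyEq (by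
    filter_upwards [isOpen_upperHalfPlaneSet.mem_nhds hz] with w hw
    exact eisTheta₄_pow_mul_disc hw))
  have h4 := eisTheta₄_pow_mul_disc hz
  have hne : eisTheta₄ z ≠ 0 := by
    intro h
    rw [h] at h4
    exact pow_ne_zero 2 (disc_ne_zero (z / 2)) (by simpa using h4.symm)
  refine hd.congr_deriv (mul_left_cancel₀ (mul_ne_zero (pow_ne_zero 5 hne) (disc_ne_zero z)) ?_)
  simp only [Pi.pow_apply, Function.comp_apply, id] at h3
  push_cast at h3
  norm_num at h3
  linear_combination h3 / 6 + (π * I / 3 * eisTwo (z / 2)) * (-h4)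

/-! ### The product identity on the imaginary axis -/

/-- The nome `q = exp (-π t)`. -/
def nome (t : ℝ) : ℂ := (Real.exp (-π * t) : ℝ)

theorem norm_nome_lt_one {t : ℝ} (ht : 0 < t) : ‖nome t‖ < 1 := by
  rw [nome, norm_real, Real.norm_of_nonneg (Real.exp_pos _).le, Real.exp_lt_one_iff]
  nlinarith [Real.pi_pos]

theorem nome_pow (t : ℝ) (n : ℕ) : nome t ^ n = (Real.exp (-π * n * t) : ℝ) := by
  rw [nome, ← ofReal_pow, ← Real.exp_nat_mul]
  congr 2
  ring

theorem cexp_I_mul_div_two (t : ℝ) : cexp (2 * π * I * (I * t / 2)) = nome t := by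
  rw [nome, ofReal_exp]
  congr 1
  push_cast
  linear_combination (π * t) * I_sq

theorem cexp_I_mul (t : ℝ) : cexp (2 * π * I * (I * t)) = nome t ^ 2 := by
  rw [cexp_eq_sq, cexp_I_mul_div_two]

theorem cexp_two_mul_I_mul (t : ℝ) : cexp (2 * π * I * (2 * (I * t))) = nome t ^ 4 := by
  rw [cexp_eq_sq, mul_div_cancel_left₀ _ two_ne_zero, cexp_I_mul, ← pow_mul]

theorem im_I_mul_pos {t : ℝ} (ht : 0 < t) : 0 < (I * t).im := by simpa using ht

theorem eisTheta₄_I_mul {t : ℝ} (ht : 0 < t) : eisTheta₄ (I * t) =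
    1 - 8 * sigmaGen (nome t) + 48 * sigmaGen (nome t ^ 2) - 64 * sigmaGen (nome t ^ 4) := by
  have h := im_I_mul_pos ht
  rw [eisTheta₄, eisTwo_eq_sigmaGen (im_two_mul_pos h), cexp_two_mul_I_mul,
    eisTwo_eq_sigmaGen (im_add_one_div_two_pos h), cexp_add_one_div_two, cexp_I_mul_div_two,
    sigmaGen_neg (norm_nome_lt_one ht)]
  ring

/-- The odd part of the σ₁ series is -1/16 times `eisTheta₂`, which inversion exchanges with
`eisTheta₄`; the factor (it)² = -t² absorbs the sign. -/
theorem sigmaGen_sub_inv {t : ℝ} (ht : 0 < t) :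
    (sigmaGen (nome t⁻¹) - sigmaGen (-nome t⁻¹)) / 2 = t ^ 2 / 16 * eisTheta₄ (I * t) := by
  have h := eisTheta₂_neg_inv (im_I_mul_pos ht)
  have h' := eisTheta₂_eq (im_I_mul_pos (inv_pos.2 ht))
  have e : -(I * t)⁻¹ = I * (t⁻¹ : ℝ) := by
    rw [mul_inv, inv_I]
    push_cast
    ring
  rw [e, h', cexp_I_mul_div_two] at h
  linear_combination (-1 / 16) * h + (t ^ 2 / 16 * eisTheta₄ (I * t)) * (-I_sq)

theorem hasDerivAt_nome (t : ℝ) : HasDerivAt nome (-π * nome t) t := by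
  have h := (((hasDerivAt_id t).const_mul (-π)).exp).ofReal_comp
  refine h.congr_deriv ?_
  simp [nome, mul_comm]

theorem hasDerivAt_sigmaGen_nome_pow {t : ℝ} (ht : 0 < t) {k : ℕ} (hk : 0 < k) :
    HasDerivAt (fun t => sigmaGen (nome t ^ k)) (-π * k * sigmaGenDeriv (nome t ^ k)) t := by
  obtain ⟨d, hd, hd'⟩ := exists_hasDerivAt_sigmaGen (norm_pow_lt_one (norm_nome_lt_one ht) hk)
  refine (hd.comp t ((hasDerivAt_nome t).fun_pow k)).congr_deriv ?_
  rw [← hd']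
  obtain ⟨m, rfl⟩ := Nat.exists_eq_succ_of_ne_zero hk.ne'
  simp only [Nat.succ_eq_add_one, Nat.add_sub_cancel, pow_succ]
  ring

/-- The t-derivative of T(it) is computed twice: from the logarithmic derivative, where E₂(it/2) -
E₂(it) is -24 times the first factor, and termwise from the q-expansion. Both carry the factor 8π.
-/
theorem sub_mul_eisTheta₄ {t : ℝ} (ht : 0 < t) :
    (sigmaGen (nome t) - sigmaGen (nome t ^ 2)) * eisTheta₄ (I * t) = sigmaGenDeriv (nome t)
      - 12 * sigmaGenDeriv (nome t ^ 2) + 32 * sigmaGenDeriv (nome t ^ 4) := by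
  have h1 := (hasDerivAt_eisTheta₄ (im_I_mul_pos ht)).comp t
    (((hasDerivAt_id t).ofReal_comp).const_mul I)
  have h2 := ((((hasDerivAt_sigmaGen_nome_pow ht one_pos).const_mul 8).const_sub 1).add
    ((hasDerivAt_sigmaGen_nome_pow ht two_pos).const_mul 48)).sub
    ((hasDerivAt_sigmaGen_nome_pow ht four_pos).const_mul 64)
  have h3 := h1.unique (h2.congr_of_eventuallyEq (by
    filter_upwards [lt_mem_nhds ht] with u hu
    simpa using eisTheta₄_I_mul hu))
  have hpi : (8 * π : ℂ) ≠ 0 := by simp [Real.pi_ne_zero]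
  rw [eisTwo_eq_sigmaGen (im_I_mul_pos ht), eisTwo_eq_sigmaGen (im_div_two_pos (im_I_mul_pos ht)),
    cexp_I_mul_div_two, cexp_I_mul] at h3
  apply mul_left_cancel₀ hpi
  simp only [pow_one, ofReal_one, mul_one] at h3
  push_cast at h3
  linear_combination h3 + (8 * π * (sigmaGen (nome t) - sigmaGen (nome t ^ 2))
    * eisTheta₄ (I * t)) * I_sq

/-- The product of the generating functions of `coeffA` at `exp (-π t)` and of `coeffB` at
`exp (-π / t)`. -/
def productAB (t : ℝ) : ℂ := (sigmaGen (nome t) - sigmaGen (nome t ^ 2)) *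
    ((sigmaGen (nome t⁻¹) - sigmaGen (-nome t⁻¹)) / 2)

/-- The combination `∑ n σ₁(n) (qⁿ - 12 q²ⁿ + 32 q⁴ⁿ)` at `q = exp (-π t)`. -/
def sigmaCombo (t : ℝ) : ℂ :=
  sigmaGenDeriv (nome t) - 12 * sigmaGenDeriv (nome t ^ 2) + 32 * sigmaGenDeriv (nome t ^ 4)

theorem productAB_eq {t : ℝ} (ht : 0 < t) : productAB t = t ^ 2 / 16 * sigmaCombo t := by
  rw [productAB, sigmaGen_sub_inv ht, sigmaCombo, ← sub_mul_eisTheta₄ ht]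
  ring

theorem continuousOn_productAB : ContinuousOn productAB (Set.Ioi 0) := by
  have h (k : ℕ) (hk : 0 < k) : ContinuousOn (fun t => sigmaGen (nome t ^ k)) (Set.Ioi 0) :=
    fun t ht => (hasDerivAt_sigmaGen_nome_pow ht hk).continuousAt.continuousWithinAt
  have h1 := h 1 one_pos
  simp only [pow_one] at h1
  have hT : ContinuousOn (fun t : ℝ => eisTheta₄ (I * t)) (Set.Ioi 0) := fun t ht =>
    ((hasDerivAt_eisTheta₄ (im_I_mul_pos ht)).continuousAt.comp
      (f := fun t : ℝ => I * t) (by fun_prop)).continuousWithinAt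
  refine ((h1.sub (h 2 two_pos)).mul
    ((by fun_prop : ContinuousOn (fun t : ℝ => (t : ℂ) ^ 2 / 16) _).mul hT)).congr fun t ht => ?_
  rw [productAB, sigmaGen_sub_inv ht]
  rfl

/-! ### Dirichlet convolutions and the termwise Mellin transform -/

theorem hasSum_pnat_of_hasSum_nat {f : ℕ → ℂ} {a : ℂ} (h0 : f 0 = 0) (h : HasSum f a) :
    HasSum (fun n : ℕ+ => f n) a := by
  refine (Function.Injective.hasSum_iff PNat.coe_injective fun n hn => ?_).2 h
  rcases Nat.eq_zero_or_pos n with rfl | hn'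
  · exact h0
  · exact absurd ⟨⟨n, hn'⟩, rfl⟩ hn

theorem hasSum_prod_mul_of_summable_norm {ι : Type*} {f g : ι → ℂ} {a b : ℂ} (hf : HasSum f a)
    (hg : HasSum g b) (hf' : Summable fun n => ‖f n‖) (hg' : Summable fun n => ‖g n‖) :
    HasSum (fun x : ι × ι => f x.1 * g x.2) (a * b) := by
  have := summable_mul_of_summable_norm hf' hg'
  exact hf.mul hg this

/-- The product of two series as a sum of Dirichlet convolutions. -/
theorem hasSum_sum_divisors_mul {f g : ℕ → ℂ} {a b : ℂ} (hf0 : f 0 = 0) (hg0 : g 0 = 0)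
    (hf : HasSum f a) (hg : HasSum g b) (hf' : Summable fun n => ‖f n‖)
    (hg' : Summable fun n => ‖g n‖) :
    HasSum (fun j : ℕ+ => ∑ d ∈ (j : ℕ).divisors, f d * g (j / d)) (a * b) := by
  have hprod : HasSum (fun x : ℕ+ × ℕ+ => f x.1 * g x.2) (a * b) :=
    hasSum_prod_mul_of_summable_norm (f := fun n : ℕ+ => f n) (g := fun n : ℕ+ => g n)
      (hasSum_pnat_of_hasSum_nat hf0 hf) (hasSum_pnat_of_hasSum_nat hg0 hg)
      (hf'.comp_injective PNat.coe_injective)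
      (hg'.comp_injective PNat.coe_injective)
  have hsigma : HasSum (fun x : Σ n : ℕ+, Nat.divisorsAntidiagonal n =>
      f (x.2 : ℕ × ℕ).1 * g (x.2 : ℕ × ℕ).2) (a * b) :=
    sigmaAntidiagonalEquivProd.hasSum_iff.2 hprod
  refine hsigma.sigma fun j => ?_
  have hfin := hasSum_fintype fun x : Nat.divisorsAntidiagonal (j : ℕ) =>
    f (x : ℕ × ℕ).1 * g (x : ℕ × ℕ).2
  rw [Finset.sum_coe_sort (Nat.divisorsAntidiagonal (j : ℕ)) fun x => f x.1 * g x.2,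
    Nat.sum_divisorsAntidiagonal fun x y => f x * g y] at hfin
  exact hfin

/-- The `j`-th convolution in the product `productAB`. -/
def convTerm (j : ℕ) (t : ℝ) : ℂ :=
  ∑ d ∈ j.divisors, (coeffA d : ℂ) * (coeffB (j / d) : ℂ)
    * (Real.exp (-π * (d * t + (j / d : ℕ) / t)) : ℝ)

theorem coeffA_zero : coeffA 0 = 0 := by simp [coeffA]

theorem coeffB_zero : coeffB 0 = 0 := by simp [coeffB]

theorem hasSum_convTerm {t : ℝ} (ht : 0 < t) :
    HasSum (fun j : ℕ+ => convTerm j t) (productAB t) := by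
  have hA (n : ℕ) : ‖(coeffA n : ℂ)‖ ≤ (n : ℝ) ^ 2 := by
    rw [norm_natCast]; exact_mod_cast coeffA_le n
  have hB (n : ℕ) : ‖(coeffB n : ℂ)‖ ≤ (n : ℝ) ^ 2 := by
    rw [norm_natCast]; exact_mod_cast coeffB_le n
  have h1 := norm_nome_lt_one ht
  have h2 := norm_nome_lt_one (inv_pos.2 ht)
  have h := hasSum_sum_divisors_mul (by simp [coeffA_zero]) (by simp [coeffB_zero])
    (hasSum_coeffA h1) (hasSum_coeffB_of_neg h2) (summable_norm_mul_pow_of_le hA h1)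
    (summable_norm_mul_pow_of_le hB h2)
  refine h.congr_fun fun j => Finset.sum_congr rfl fun d _ => ?_
  rw [nome_pow, nome_pow, mul_mul_mul_comm, ← ofReal_mul, ← Real.exp_add]
  congr 4
  rw [div_eq_mul_inv]
  ring

/-- The exponent dt + e/t is split into halves: one is at least √j by AM-GM, the other at least (t +
1/t)/2 since d, e ≥ 1. The coefficients contribute at most j², the number of divisors at most j. -/
theorem norm_convTerm_le (j : ℕ) {t : ℝ} (ht : 0 < t) :
    ‖convTerm j t‖ ≤ (j : ℝ) ^ 3 * Real.exp (-π * √j) * Real.exp (-(π / 2) * (t + 1 / t)) := by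
  have key : ∀ d ∈ j.divisors, ‖(coeffA d : ℂ) * (coeffB (j / d) : ℂ)
      * (Real.exp (-π * (d * t + (j / d : ℕ) / t)) : ℝ)‖ ≤
      (j : ℝ) ^ 2 * (Real.exp (-π * √j) * Real.exp (-(π / 2) * (t + 1 / t))) := by
    intro d hd
    obtain ⟨e, he⟩ := Nat.dvd_of_mem_divisors hd
    have hj : j ≠ 0 := (Nat.mem_divisors.1 hd).2
    have hd0 : 0 < d := Nat.pos_of_mem_divisors hd
    have he0 : 0 < e := Nat.pos_of_ne_zero fun h => hj (by rw [he, h, mul_zero])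
    have hje : j / d = e := by rw [he, Nat.mul_div_cancel_left e hd0]
    have hje' : (j : ℝ) = d * e := by exact_mod_cast he
    rw [hje, norm_mul, norm_mul, norm_natCast, norm_natCast, norm_real,
      Real.norm_of_nonneg (Real.exp_pos _).le, ← Real.exp_add]
    gcongr ?_ * Real.exp ?_
    · have h1 : (coeffA d : ℝ) ≤ (d : ℝ) ^ 2 := by exact_mod_cast coeffA_le d
      have h2 : (coeffB e : ℝ) ≤ (e : ℝ) ^ 2 := by exact_mod_cast coeffB_le e
      rw [hje', mul_pow]
      gcongr
    · have h1 : √(j : ℝ) ≤ (d * t + e / t) / 2 := by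
        rw [Real.sqrt_le_left (by positivity), hje']
        have : (d : ℝ) * e = (d * t) * (e / t) := by field_simp
        rw [this]
        nlinarith [sq_nonneg ((d : ℝ) * t - e / t)]
      have hd1 : (1 : ℝ) ≤ d := by exact_mod_cast hd0
      have he1 : (1 : ℝ) ≤ e := by exact_mod_cast he0
      have h2 : t + 1 / t ≤ d * t + e / t := by
        gcongr
        nlinarith
      nlinarith [Real.pi_pos]
  refine (norm_sum_le_of_le _ key).trans ?_
  rw [Finset.sum_const, nsmul_eq_mul, pow_succ' (j : ℝ) 2, mul_assoc, mul_assoc]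
  gcongr
  exact_mod_cast Nat.card_divisors_le_self j

theorem summable_pow_mul_exp_sqrt :
    Summable fun j : ℕ => (j : ℝ) ^ 3 * Real.exp (-π * √j) := by
  -- The tenth Taylor term gives exp(π√j) ≥ j⁵/10!, leaving j³ · 10!/j⁵ = 10!/j².
  refine ((Real.summable_one_div_nat_pow.2 one_lt_two).mul_left
    (Nat.factorial 10 : ℝ)).of_nonneg_of_le (fun j => by positivity) fun j => ?_
  rcases Nat.eq_zero_or_pos j with rfl | hj
  · simp
  have hj' : (0 : ℝ) < j := by exact_mod_cast hj
  have h1 : (j : ℝ) ^ 5 / Nat.factorial 10 ≤ Real.exp (π * √j) := by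
    refine le_trans ?_ (Real.pow_div_factorial_le_exp (π * √j) (by positivity) 10)
    gcongr
    have : (√(j : ℝ)) ^ 10 = (j : ℝ) ^ 5 := by
      rw [show 10 = 2 * 5 by norm_num, pow_mul, Real.sq_sqrt hj'.le]
    rw [← this]
    gcongr
    nlinarith [Real.pi_gt_three, Real.sqrt_nonneg (j : ℝ)]
  rw [neg_mul, Real.exp_neg, ← div_eq_mul_inv, div_le_iff₀ (Real.exp_pos _)]
  calc (j : ℝ) ^ 3 = Nat.factorial 10 * (1 / j ^ 2) * (j ^ 5 / Nat.factorial 10) := by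
        field_simp
    _ ≤ _ := by gcongr

/-- A bound of both exponential decay at infinity and at zero. -/
def decay (t : ℝ) : ℝ := Real.exp (-(π / 2) * (t + 1 / t))

theorem norm_decay (t : ℝ) : ‖decay t‖ = decay t := Real.norm_of_nonneg (Real.exp_pos _).le

theorem decay_isBigO_atTop (a : ℝ) : decay =O[atTop] fun t : ℝ => t ^ (-a) := by
  refine Asymptotics.IsBigO.trans ?_
    (isLittleO_exp_neg_mul_rpow_atTop (by positivity : 0 < π / 2) (-a)).isBigO
  refine .of_bound 1 ?_
  filter_upwards [eventually_gt_atTop 0] with t ht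
  rw [one_mul, norm_decay, decay, Real.norm_of_nonneg (Real.exp_pos _).le, Real.exp_le_exp]
  have : 0 < 1 / t := by positivity
  nlinarith [Real.pi_pos]

theorem decay_inv (t : ℝ) : decay t⁻¹ = decay t := by
  simp [decay, add_comm]

/-- The symmetry t ↔ 1/t transports the estimate at infinity. -/
theorem decay_isBigO_zero (b : ℝ) : decay =O[𝓝[>] 0] fun t : ℝ => t ^ (-b) := by
  refine ((decay_isBigO_atTop (-b)).comp_tendsto tendsto_inv_nhdsGT_zero).congr' ?_ ?_
  · exact Eventually.of_forall decay_inv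
  · filter_upwards [self_mem_nhdsWithin] with t ht
    rw [Function.comp_apply, Real.inv_rpow (le_of_lt ht), ← Real.rpow_neg (le_of_lt ht), neg_neg]

theorem continuousOn_decay : ContinuousOn decay (Set.Ioi 0) := by
  unfold decay
  fun_prop (disch := intro x hx; exact ne_of_gt hx)

theorem mellinConvergent_of_norm_le_decay {f : ℝ → ℂ} {C : ℝ} (hf : ContinuousOn f (Set.Ioi 0))
    (h : ∀ t, 0 < t → ‖f t‖ ≤ C * decay t) (s : ℂ) :
    MellinConvergent f s ∧ DifferentiableAt ℂ (mellin f) s := by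
  have hloc := hf.locallyIntegrableOn measurableSet_Ioi (μ := volume)
  have htop : f =O[atTop] decay := by
    refine .of_bound C ?_
    filter_upwards [eventually_gt_atTop 0] with t ht
    rw [norm_decay]
    exact h t ht
  have hzero : f =O[𝓝[>] 0] decay := by
    refine .of_bound C ?_
    filter_upwards [self_mem_nhdsWithin] with t ht
    rw [norm_decay]
    exact h t ht
  have h1 := htop.trans (decay_isBigO_atTop (s.re + 1))
  have h2 := hzero.trans (decay_isBigO_zero (s.re - 1))
  exact ⟨mellinConvergent_of_isBigO_rpow hloc h1 (by simp) h2 (by simp),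
    mellin_differentiableAt_of_isBigO_rpow hloc h1 (by simp) h2 (by simp)⟩

theorem continuousOn_convTerm (j : ℕ) : ContinuousOn (convTerm j) (Set.Ioi 0) := by
  unfold convTerm
  refine continuousOn_finsetSum _ fun d _ => ?_
  refine continuousOn_const.mul (continuous_ofReal.comp_continuousOn ?_)
  fun_prop (disch := intro x hx; exact ne_of_gt hx)

theorem hasSum_mellin_convTerm (s : ℂ) :
    HasSum (fun j : ℕ+ => mellin (convTerm j) s) (mellin productAB s) := by
  have hconv (j : ℕ) := (mellinConvergent_of_norm_le_decay (continuousOn_convTerm j)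
    (fun t ht => norm_convTerm_le j ht) s).1
  have hdec : IntegrableOn (fun t : ℝ => ‖(t : ℂ) ^ (s - 1)‖ * decay t) (Set.Ioi 0) := by
    have := (mellinConvergent_of_norm_le_decay (f := fun t => (decay t : ℂ)) (C := 1)
      (continuous_ofReal.comp_continuousOn continuousOn_decay) (fun t ht => by
        rw [norm_real, norm_decay, one_mul]) s).1.norm
    refine this.congr (Eventually.of_forall fun t => ?_)
    simp only [norm_smul, norm_real, norm_decay]
  have h := hasSum_integral_of_summable_integral_norm (μ := volume.restrict (Set.Ioi 0))
    (F := fun (j : ℕ+) (t : ℝ) => (t : ℂ) ^ (s - 1) • convTerm j t) (fun j => hconv j) ?_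
  · convert! h using 1
    refine setIntegral_congr_fun measurableSet_Ioi fun t ht => ?_
    simp only [smul_eq_mul]
    rw [tsum_mul_left, (hasSum_convTerm ht).tsum_eq]
  · have hs := (summable_pow_mul_exp_sqrt.comp_injective PNat.coe_injective).mul_right
      (∫ t in Set.Ioi (0 : ℝ), ‖(t : ℂ) ^ (s - 1)‖ * decay t)
    refine hs.of_nonneg_of_le (fun j => integral_nonneg fun t => norm_nonneg _) fun j => ?_
    rw [← integral_const_mul]
    refine setIntegral_mono_on (hconv j).norm (hdec.const_mul _) measurableSet_Ioi fun t ht => ?_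
    rw [norm_smul, Function.comp_apply, mul_left_comm]
    gcongr
    exact norm_convTerm_le j ht

/-- Summing the termwise bounds over j dominates the product by a constant multiple of `decay`,
which beats every power of t at both ends. -/
theorem differentiable_mellin_productAB : Differentiable ℂ (mellin productAB) := by
  intro s
  refine (mellinConvergent_of_norm_le_decay (C := ∑' j : ℕ+, (j : ℝ) ^ 3 * Real.exp (-π * √j))
    continuousOn_productAB (fun t ht => ?_) s).2
  have hs := summable_pow_mul_exp_sqrt.comp_injective PNat.coe_injective
  rw [← (hasSum_convTerm ht).tsum_eq, ← tsum_mul_right]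
  exact tsum_of_norm_bounded (hs.mul_right (decay t)).hasSum fun j => norm_convTerm_le j ht

/-! ### Bessel functions as Mellin transforms -/

theorem mellin_exp_add_inv {d e : ℝ} (hd : 0 < d) (he : 0 < e) (s : ℂ) :
    mellin (fun t => ((Real.exp (-π * (d * t + e / t)) : ℝ) : ℂ)) s =
      2 * (((e / d : ℝ) : ℂ) ^ (s / 2) * besselK s (2 * π * √(d * e))) := by
  -- The substitution u = √(d/e) t makes the exponent symmetric, a multiple of u + 1/u.
  have ha : 0 < √(d / e) := by positivity
  have h := mellin_comp_mul_left
    (fun u : ℝ => ((Real.exp (-(2 * π * √(d * e) / 2) * (u + 1 / u)) : ℝ) : ℂ)) s ha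
  have hf : ∀ t : ℝ, -(2 * π * √(d * e) / 2) * (√(d / e) * t + 1 / (√(d / e) * t)) =
      -π * (d * t + e / t) := by
    intro t
    have h1 : √(d * e) * √(d / e) = d := by
      rw [← Real.sqrt_mul (by positivity), show d * e * (d / e) = d ^ 2 by field_simp,
        Real.sqrt_sq hd.le]
    have h2 : √(d * e) / √(d / e) = e := by
      rw [← Real.sqrt_div (by positivity), show d * e / (d / e) = e ^ 2 by field_simp,
        Real.sqrt_sq he.le]
    calc _ = -π * (√(d * e) * √(d / e) * t + √(d * e) / √(d / e) / t) := by
          rw [one_div, mul_inv]; ring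
      _ = _ := by rw [h1, h2]
  simp only [hf] at h
  rw [h]
  have hpow : ((√(d / e) : ℝ) : ℂ) ^ (-s) = ((e / d : ℝ) : ℂ) ^ (s / 2) := by
    rw [cpow_def_of_ne_zero (by exact_mod_cast ha.ne'), cpow_def_of_ne_zero
      (by exact_mod_cast (div_pos he hd).ne'), ← ofReal_log ha.le,
      ← ofReal_log (div_pos he hd).le, Real.log_sqrt (by positivity), ← inv_div e d, Real.log_inv]
    push_cast
    ring_nf
  rw [hpow, besselK, mellin, smul_eq_mul]
  simp only [smul_eq_mul]
  ring

theorem exp_add_inv_le_decay {d e t : ℝ} (hd : 1 ≤ d) (he : 1 ≤ e) (ht : 0 < t) :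
    Real.exp (-π * (d * t + e / t)) ≤ decay t := by
  rw [decay, Real.exp_le_exp]
  have h1 : t ≤ d * t := le_mul_of_one_le_left ht.le hd
  have h2 : 1 / t ≤ e / t := by gcongr
  have h3 : 0 < 1 / t := by positivity
  nlinarith [Real.pi_pos]

theorem mellin_sum {ι : Type*} (u : Finset ι) {f : ι → ℝ → ℂ} {s : ℂ}
    (hf : ∀ i ∈ u, MellinConvergent (f i) s) :
    mellin (fun t => ∑ i ∈ u, f i t) s = ∑ i ∈ u, mellin (f i) s := by
  simp only [mellin, Finset.smul_sum]
  exact integral_finsetSum u hf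

theorem besselTerm_eq_mellin (s : ℂ) (j : ℕ) :
    besselTerm s j = mellin (convTerm j) s / 2 := by
  have hterm (d : ℕ) (hd : d ∈ j.divisors) : 0 < d ∧ 0 < j / d ∧ d * (j / d) = j :=
    ⟨Nat.pos_of_mem_divisors hd, Nat.div_pos (Nat.divisor_le hd) (Nat.pos_of_mem_divisors hd),
      Nat.mul_div_cancel' (Nat.dvd_of_mem_divisors hd)⟩
  have hsum : mellin (convTerm j) s = _ := mellin_sum j.divisors fun d hd => by
    obtain ⟨h1, h2, -⟩ := hterm d hd
    simp only [← smul_eq_mul (a := (coeffA d : ℂ) * (coeffB (j / d) : ℂ))]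
    refine MellinConvergent.const_smul (mellinConvergent_of_norm_le_decay (C := 1)
      (continuous_ofReal.comp_continuousOn ?_) (fun t ht => ?_) s).1 _
    · fun_prop (disch := intro x hx; exact ne_of_gt hx)
    · rw [Function.comp_apply, norm_real, Real.norm_of_nonneg (Real.exp_pos _).le, one_mul]
      exact exp_add_inv_le_decay (by exact_mod_cast h1) (by exact_mod_cast h2) ht
  rw [hsum, Finset.sum_div, besselTerm]
  refine Finset.sum_congr rfl fun d hd => ?_
  obtain ⟨h1, h2, h3⟩ := hterm d hd
  have h1' : (0 : ℝ) < d := by exact_mod_cast h1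
  have h2' : (0 : ℝ) < (j / d : ℕ) := by exact_mod_cast h2
  have h3' : (d : ℝ) * (j / d : ℕ) = j := by exact_mod_cast h3
  simp only [← smul_eq_mul (a := (coeffA d : ℂ) * (coeffB (j / d) : ℂ))]
  rw [mellin_const_smul, mellin_exp_add_inv h1' h2', h3', smul_eq_mul]
  have h4 : (((j / d : ℕ) / d : ℝ) : ℂ) = (j : ℂ) / (d : ℂ) ^ 2 := by
    rw [← ofReal_natCast j, ← h3']
    have : (d : ℂ) ≠ 0 := by exact_mod_cast h1.ne'
    push_cast
    field_simp
  rw [h4, smul_eq_mul]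
  ring

theorem hasSum_besselTerm (s : ℂ) :
    HasSum (fun j : ℕ+ => besselTerm s j) (mellin productAB s / 2) := by
  simp only [besselTerm_eq_mellin]
  exact (hasSum_mellin_convTerm s).div_const 2

/-! ### The Dirichlet series and the zeta side for Re s > 1 -/

theorem hasSum_one_div_cpow {s : ℂ} (hs : 1 < s.re) :
    HasSum (fun n : ℕ => 1 / (n : ℂ) ^ s) (riemannZeta s) := by
  rw [zeta_eq_tsum_one_div_nat_cpow hs]
  exact (Complex.summable_one_div_nat_cpow.2 hs).hasSum

theorem summable_norm_one_div_cpow {s : ℂ} (hs : 1 < s.re) :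
    Summable fun n : ℕ => ‖1 / (n : ℂ) ^ s‖ :=
  (Complex.summable_one_div_nat_cpow.2 hs).norm

/-- Since d/n^{s+1} = d^{-s} (n/d)^{-(s+1)} for d ∣ n, this is the Dirichlet product of the series
for ζ(s) and ζ(s+1). -/
theorem hasSum_pnat_sigma_div_cpow {s : ℂ} (hs : 1 < s.re) :
    HasSum (fun n : ℕ+ => (σ 1 n : ℂ) / (n : ℂ) ^ (s + 1))
      (riemannZeta s * riemannZeta (s + 1)) := by
  have hs' : 1 < (s + 1).re := by simp; linarith
  have h0 : s ≠ 0 := fun h => by norm_num [h] at hs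
  have h0' : s + 1 ≠ 0 := fun h => by norm_num [h] at hs'
  have h := hasSum_sum_divisors_mul (by simp [h0]) (by simp [h0']) (hasSum_one_div_cpow hs)
    (hasSum_one_div_cpow hs') (summable_norm_one_div_cpow hs) (summable_norm_one_div_cpow hs')
  refine h.congr_fun fun n => ?_
  rw [ArithmeticFunction.sigma_one_apply, Nat.cast_sum, Finset.sum_div]
  refine Finset.sum_congr rfl fun d hd => ?_
  have hd0 : (d : ℂ) ≠ 0 := by exact_mod_cast (Nat.pos_of_mem_divisors hd).ne'
  have hn : ((n : ℕ) : ℂ) ^ (s + 1) = (d : ℂ) ^ (s + 1) * ((n / d : ℕ) : ℂ) ^ (s + 1) := by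
    rw [← natCast_mul_natCast_cpow, ← Nat.cast_mul,
      Nat.mul_div_cancel' (Nat.dvd_of_mem_divisors hd)]
  rw [hn, cpow_add _ _ hd0, cpow_one]
  rw [div_mul_div_comm, one_mul, mul_assoc, mul_left_comm, ← div_div, div_self hd0]

theorem hasSum_mul_sigma_div_cpow {s : ℂ} (hs : 1 < s.re) :
    HasSum (fun n : ℕ => (n : ℂ) * (σ 1 n : ℂ) / (n : ℂ) ^ (s + 2))
      (riemannZeta s * riemannZeta (s + 1)) := by
  rw [← Function.Injective.hasSum_iff PNat.coe_injective]
  · refine (hasSum_pnat_sigma_div_cpow hs).congr_fun fun n => ?_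
    have hn : ((n : ℕ) : ℂ) ≠ 0 := by exact_mod_cast n.ne_zero
    rw [Function.comp_apply, show s + 2 = 1 + (s + 1) by ring, cpow_add 1 _ hn, cpow_one,
      mul_div_mul_left _ _ hn]
  · intro n hn
    rcases Nat.eq_zero_or_pos n with rfl | hn'
    · simp
    · exact absurd ⟨⟨n, hn'⟩, rfl⟩ hn

/-- The coefficients of `sigmaCombo`. -/
def comboCoeff (n : ℕ) : ℂ := (n : ℂ) * (σ 1 n : ℂ)
  - 12 * (if 2 ∣ n then ((n / 2 : ℕ) : ℂ) * (σ 1 (n / 2) : ℂ) else 0)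
  + 32 * (if 4 ∣ n then ((n / 4 : ℕ) : ℂ) * (σ 1 (n / 4) : ℂ) else 0)

theorem hasSum_comboCoeff {t : ℝ} (ht : 0 < t) :
    HasSum (fun n => comboCoeff n * (Real.exp (-π * n * t) : ℝ)) (sigmaCombo t) := by
  have hq := norm_nome_lt_one ht
  have h (k : ℕ) (hk : 0 < k) := hasSum_mul_pow_of_hasSum_pow
    (c := fun n => (n : ℂ) * (σ 1 n : ℂ)) hk (hasSum_sigmaGenDeriv (norm_pow_lt_one hq hk))
  refine (((hasSum_sigmaGenDeriv hq).sub ((h 2 two_pos).mul_left 12)).add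
    ((h 4 four_pos).mul_left 32)).congr_fun fun n => ?_
  rw [← nome_pow, comboCoeff]
  ring

/-- Passing from q to q^k multiplies the Dirichlet series by k^{-(s+2)}, so the weights 12 and 32
become 12/2² = 3 and 32/4² = 2. -/
theorem hasSum_comboCoeff_div_cpow {s : ℂ} (hs : 1 < s.re) :
    HasSum (fun n => comboCoeff n / (n : ℂ) ^ (s + 2))
      ((1 - 3 * 2 ^ (-s) + 2 * 4 ^ (-s)) * (riemannZeta s * riemannZeta (s + 1))) := by
  have h1 := hasSum_mul_sigma_div_cpow hs
  have h (k : ℕ) (hk : 0 < k) : HasSum (fun n : ℕ =>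
      (if k ∣ n then ((n / k : ℕ) : ℂ) * (σ 1 (n / k) : ℂ) else 0) / (n : ℂ) ^ (s + 2))
      ((k : ℂ) ^ (-s) / (k : ℂ) ^ 2 * (riemannZeta s * riemannZeta (s + 1))) := by
    have hk0 : (k : ℂ) ≠ 0 := by exact_mod_cast hk.ne'
    refine (hasSum_ite_dvd hk (h1.mul_left ((k : ℂ) ^ (-s) / (k : ℂ) ^ 2))).congr_fun fun n => ?_
    split_ifs with hn
    · have hn : ((n : ℕ) : ℂ) ^ (s + 2) = (k : ℂ) ^ (s + 2) * ((n / k : ℕ) : ℂ) ^ (s + 2) := by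
        rw [← natCast_mul_natCast_cpow, ← Nat.cast_mul, Nat.mul_div_cancel' hn]
      rw [hn, cpow_neg, cpow_add (x := (k : ℂ)) _ _ hk0, cpow_ofNat, div_mul_eq_div_div]
      simp only [div_eq_mul_inv, mul_inv]
      ring
    · rw [zero_div]
  convert! (h1.sub ((h 2 two_pos).mul_left 12)).add ((h 4 four_pos).mul_left 32) using 1
  · ext n
    rw [comboCoeff]
    ring
  · push_cast
    ring

theorem summable_comboCoeff_div_rpow {s : ℂ} (hs : 1 < s.re) :
    Summable fun n : ℕ => ‖comboCoeff n‖ / (n : ℝ) ^ (s + 2).re := by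
  have h := (hasSum_comboCoeff_div_cpow hs).summable.norm
  refine h.congr fun n => ?_
  have h2 : (s + 2).re ≠ 0 := by simp; linarith
  rw [norm_div, norm_natCast_cpow_of_re_ne_zero n h2]

theorem mellin_productAB_eq {s : ℂ} (hs : 1 < s.re) :
    mellin productAB s = (π : ℂ) ^ (-(s + 2)) * Complex.Gamma (s + 2) / 16 *
      ((1 - 3 * 2 ^ (-s) + 2 * 4 ^ (-s)) * (riemannZeta s * riemannZeta (s + 1))) := by
  -- The factor t² shifts the Mellin variable from s to s + 2.
  have h1 : mellin productAB s = mellin sigmaCombo (s + 2) / 16 := by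
    rw [← mellin_cpow_smul, ← mellin_div_const]
    refine setIntegral_congr_fun measurableSet_Ioi fun t ht => ?_
    simp only [productAB_eq ht, smul_eq_mul, cpow_ofNat]
    ring
  have h2 := hasSum_mellin_pi_mul (a := comboCoeff) (q := fun n : ℕ => (n : ℝ)) (s := s + 2)
    (F := sigmaCombo) (fun n => ?_) (by simp; linarith) (fun t ht => hasSum_comboCoeff ht)
    (summable_comboCoeff_div_rpow hs)
  · have h3 := (hasSum_comboCoeff_div_cpow hs).mul_left
      ((π : ℂ) ^ (-(s + 2)) * Complex.Gamma (s + 2))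
    rw [h1, h2.unique (h3.congr_fun fun n => by push_cast; ring)]
    ring
  · rcases Nat.eq_zero_or_pos n with rfl | hn
    · left
      simp [comboCoeff]
    · right
      exact_mod_cast hn

theorem zetaSide_eq_of_one_lt_re {s : ℂ} (hs : 1 < s.re) :
    zetaSide s = mellin productAB s / 2 := by
  have h0 : s ≠ 0 := fun h => by norm_num [h] at hs
  have h1 : s + 1 ≠ 0 := fun h => by
    rw [eq_neg_of_add_eq_zero_left h] at hs
    norm_num at hs
  have hpi : (π : ℂ) ≠ 0 := by exact_mod_cast Real.pi_ne_zero
  have hG : Complex.Gamma (s + 2) = (s + 1) * (s * Complex.Gamma s) := by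
    rw [show s + 2 = s + 1 + 1 by ring, Complex.Gamma_add_one _ h1, Complex.Gamma_add_one _ h0]
  have hdup := Complex.Gamma_mul_Gamma_add_half (s / 2)
  rw [show s / 2 + 1 / 2 = (s + 1) / 2 by ring, show 2 * (s / 2) = s by ring] at hdup
  have hx0 : (2 : ℂ) ^ (s / 2) ≠ 0 := by simp [cpow_eq_zero_iff]
  have hr : ((√2 : ℝ) : ℂ) ^ 2 = 2 := by
    rw [← ofReal_pow, Real.sq_sqrt zero_le_two, ofReal_ofNat]
  have hr0 : ((√2 : ℝ) : ℂ) ≠ 0 := fun h => by norm_num [h] at hr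
  have hrc : (2 : ℂ) ^ (1 / 2 : ℂ) = (√2 : ℝ) := by
    rw [Real.sqrt_eq_rpow, ofReal_cpow zero_le_two]
    norm_num
  have hwc : (π : ℂ) ^ (1 / 2 : ℂ) = (√π : ℝ) := by
    rw [Real.sqrt_eq_rpow, ofReal_cpow Real.pi_pos.le]
    norm_num
  have hw0 : ((√π : ℝ) : ℂ) ≠ 0 := by exact_mod_cast (Real.sqrt_pos.2 Real.pi_pos).ne'
  have e1 : (2 : ℂ) ^ (-s / 2) = ((2 : ℂ) ^ (s / 2))⁻¹ := by rw [neg_div, cpow_neg]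
  have e2 : (2 : ℂ) ^ ((s - 1) / 2) = (2 : ℂ) ^ (s / 2) / (√2 : ℝ) := by
    rw [sub_div, cpow_sub _ _ two_ne_zero, hrc]
  have e3 : (2 : ℂ) ^ (-(s - 1) / 2) = (√2 : ℝ) / (2 : ℂ) ^ (s / 2) := by
    rw [neg_sub, sub_div, cpow_sub _ _ two_ne_zero, hrc]
  have e4 : (2 : ℂ) ^ (-s) = (((2 : ℂ) ^ (s / 2)) ^ 2)⁻¹ := by
    rw [← cpow_nat_mul, ← cpow_neg]
    congr 1
    push_cast
    ring
  have e5 : (4 : ℂ) ^ (-s) = (((2 : ℂ) ^ (s / 2)) ^ 4)⁻¹ := by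
    rw [show (4 : ℂ) = (2 : ℕ) * (2 : ℕ) by norm_num, natCast_mul_natCast_cpow, Nat.cast_ofNat, e4]
    ring
  have e6 : (2 : ℂ) ^ (1 - s) = 2 / ((2 : ℂ) ^ (s / 2)) ^ 2 := by
    rw [sub_eq_add_neg, cpow_add _ _ two_ne_zero, e4, cpow_one]
    rfl
  have e7 : (π : ℂ) ^ (-(s + 1) / 2) = (π : ℂ) ^ (-s / 2) / (√π : ℝ) := by
    rw [neg_add, add_div, cpow_add _ _ hpi, neg_div 2 (1 : ℂ), cpow_neg _ (1 / 2), hwc]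
    rfl
  have e8 : (π : ℂ) ^ (-(s + 2)) = ((π : ℂ) ^ (-s / 2)) ^ 2 / (π : ℂ) ^ 2 := by
    rw [neg_add, cpow_add _ _ hpi, cpow_neg _ 2, cpow_ofNat, ← cpow_nat_mul, div_eq_mul_inv]
    congr 2
    push_cast
    ring
  rw [e6] at hdup
  rw [mellin_productAB_eq hs, hG, zetaSide, zetaStar, zetaStar, e1, e2, e3, e4, e5, e7, e8]
  generalize (2 : ℂ) ^ (s / 2) = x at *
  generalize (π : ℂ) ^ (-s / 2) = p at *
  generalize ((√2 : ℝ) : ℂ) = r at *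
  generalize ((√π : ℝ) : ℂ) = w at *
  -- With x = 2^{s/2} and r = √2, what remains is rational: the duplication formula merges the Gamma
  -- factors, and (x² - 1)(x² - 2)/x⁴ = 1 - 3x⁻² + 2x⁻⁴.
  calc _ = s * (s + 1) / (32 * (π : ℂ) ^ 2 * r) * (x - x⁻¹) * (x / r - r / x) * p * (p / w) *
        (Complex.Gamma (s / 2) * Complex.Gamma ((s + 1) / 2)) * riemannZeta s *
        riemannZeta (s + 1) := by ring
    _ = s * (s + 1) * Complex.Gamma s * p ^ 2 / (16 * (π : ℂ) ^ 2 * r ^ 2 * x ^ 4) *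
        ((x ^ 2 - 1) * (x ^ 2 - r ^ 2)) * riemannZeta s * riemannZeta (s + 1) := by
      rw [hdup]
      field_simp
      ring
    _ = _ := by
      rw [hr]
      field_simp
      ring

/-! ### Analytic continuation and removable singularities -/

/-- The points at which a factor of `zetaSide` is not defined. -/
def zetaSideSingular : Set ℂ := insert 1 (Set.range fun n : ℕ => -(n : ℂ))

/-- Distinct integers are at distance at least 1. Arbitrary subsets are allowed so that a single
singular point can later be left out. -/
theorem isClosed_of_subset_zetaSideSingular {A : Set ℂ} (hA : A ⊆ zetaSideSingular) :
    IsClosed A := by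
  have hint : ∀ z ∈ A, ∃ m : ℤ, (m : ℂ) = z := by
    intro z hz
    rcases hA hz with rfl | ⟨n, rfl⟩
    · exact ⟨1, by simp⟩
    · exact ⟨-n, by simp⟩
  refine Metric.isClosed_of_pairwise_le_dist one_pos fun x hx y hy hxy => ?_
  obtain ⟨m, rfl⟩ := hint x hx
  obtain ⟨n, rfl⟩ := hint y hy
  rw [Complex.dist_eq, ← Int.cast_sub, norm_intCast]
  have : m - n ≠ 0 := sub_ne_zero.2 fun h => hxy (by rw [h])
  exact_mod_cast Int.one_le_abs this

theorem mem_compl_zetaSideSingular {s : ℂ} :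
    s ∈ zetaSideSingularᶜ ↔ s ≠ 1 ∧ ∀ n : ℕ, s ≠ -(n : ℂ) := by
  simp only [zetaSideSingular, Set.mem_compl_iff, Set.mem_insert_iff, Set.mem_range, not_or,
    not_exists]
  exact and_congr Iff.rfl (forall_congr' fun n => ne_comm)

theorem differentiableAt_zetaStar {s : ℂ} (h1 : s ≠ 1) (h : ∀ n : ℕ, s ≠ -(2 * n)) :
    DifferentiableAt ℂ zetaStar s := by
  have hpi : (π : ℂ) ≠ 0 := by exact_mod_cast Real.pi_ne_zero
  have hG : DifferentiableAt ℂ (fun s : ℂ => Complex.Gamma (s / 2)) s :=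
    (Complex.differentiableAt_Gamma (s / 2) fun n hn => h n (by
      rw [div_eq_iff two_ne_zero] at hn
      rw [hn]; ring)).comp s (f := fun s : ℂ => s / 2) (by fun_prop)
  have hp : DifferentiableAt ℂ (fun s : ℂ => (π : ℂ) ^ (-s / 2)) s :=
    DifferentiableAt.const_cpow (by fun_prop) (Or.inl hpi)
  exact (hp.fun_mul hG).fun_mul (differentiableAt_riemannZeta h1)

theorem differentiableAt_zetaSide {s : ℂ} (hs : s ∈ zetaSideSingularᶜ) :
    DifferentiableAt ℂ zetaSide s := by
  obtain ⟨h1, h⟩ := mem_compl_zetaSideSingular.1 hs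
  have hz := differentiableAt_zetaStar h1 fun n hn => h (2 * n) (by push_cast; exact hn)
  have hz1 : DifferentiableAt ℂ (fun s => zetaStar (s + 1)) s :=
    (differentiableAt_zetaStar (s := s + 1) (fun hn => h 0 (by simpa using hn)) fun n hn =>
      h (2 * n + 1) (by
        push_cast
        linear_combination hn)).comp s (f := fun s : ℂ => s + 1) (by fun_prop)
  have hc (f : ℂ → ℂ) (hf : Differentiable ℂ f) : DifferentiableAt ℂ (fun s => (2 : ℂ) ^ f s) s :=
    DifferentiableAt.const_cpow hf.differentiableAt (Or.inl two_ne_zero)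
  have c1 := hc (fun s => s / 2) (by fun_prop)
  have c2 := hc (fun s => -s / 2) (by fun_prop)
  have c3 := hc (fun s => (s - 1) / 2) (by fun_prop)
  have c4 := hc (fun s => -(s - 1) / 2) (by fun_prop)
  have c0 : DifferentiableAt ℂ
    (fun s : ℂ => s * (s + 1) / (32 * (π : ℂ) ^ 2 * (√2 : ℝ))) s := by fun_prop
  exact (((c0.fun_mul (c1.fun_sub c2)).fun_mul (c3.fun_sub c4)).fun_mul hz).fun_mul hz1

theorem zetaSide_eq {s : ℂ} (hs : s ∈ zetaSideSingularᶜ) : zetaSide s = mellin productAB s / 2 := by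
  have hopen : IsOpen zetaSideSingularᶜ := (isClosed_of_subset_zetaSideSingular le_rfl).isOpen_compl
  have hcount : zetaSideSingular.Countable := (Set.countable_range _).insert 1
  -- The complement of a countable set in the plane is path connected.
  have hconn : IsPreconnected zetaSideSingularᶜ :=
    (hcount.isPathConnected_compl_of_one_lt_rank (by simp)).isConnected.isPreconnected
  have hf : AnalyticOnNhd ℂ zetaSide zetaSideSingularᶜ := DifferentiableOn.analyticOnNhd
    (fun s hs => (differentiableAt_zetaSide hs).differentiableWithinAt) hopen
  have hg : AnalyticOnNhd ℂ (fun s => mellin productAB s / 2) zetaSideSingularᶜ :=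
    (differentiable_mellin_productAB.div_const 2).differentiableOn.analyticOnNhd hopen
  have h2 : (2 : ℂ) ∈ zetaSideSingularᶜ := by
    refine mem_compl_zetaSideSingular.2 ⟨by norm_num, fun n hn => ?_⟩
    have : ((2 + n : ℕ) : ℂ) = 0 := by push_cast; rw [hn]; ring
    exact absurd (Nat.cast_eq_zero.1 this) (by omega)
  refine hf.eqOn_of_preconnected_of_eventuallyEq hg hconn h2 ?_ hs
  filter_upwards [(isOpen_lt continuous_const Complex.continuous_re).mem_nhds
    (show (1 : ℝ) < (2 : ℂ).re by norm_num)] with z hz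
  exact zetaSide_eq_of_one_lt_re hz

end

theorem lemma1 (s : ℂ) :
    ∃ S : ℂ, HasSum (fun j : ℕ+ => besselTerm s (j : ℕ)) S ∧
      ((s ≠ 1 ∧ ∀ n : ℕ, s ≠ -(n : ℂ)) → zetaSide s = S) ∧
      Tendsto zetaSide (𝓝[≠] s) (𝓝 S) := by
  refine ⟨mellin productAB s / 2, hasSum_besselTerm s,
    fun h => zetaSide_eq (mem_compl_zetaSideSingular.2 h), ?_⟩
  have hcont : Tendsto (fun s => mellin productAB s / 2) (𝓝[≠] s) (𝓝 (mellin productAB s / 2)) :=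
    (differentiable_mellin_productAB.div_const 2).continuous.continuousAt.tendsto.mono_left
      nhdsWithin_le_nhds
  refine hcont.congr' ?_
  -- Whether or not s is singular, a punctured neighbourhood of s avoids all the singular points.
  have hmem : (zetaSideSingular \ {s})ᶜ ∈ 𝓝 s :=
    (isClosed_of_subset_zetaSideSingular Set.sdiff_subset).isOpen_compl.mem_nhds (by simp)
  filter_upwards [nhdsWithin_le_nhds hmem, self_mem_nhdsWithin] with z hz hne
  exact (zetaSide_eq fun h => hz ⟨h, hne⟩).symm
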